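/- **Setting.** Let $\mathcal X\subset\mathbb C$ be finite, $p,q\ge1$, let $\omega_{1,1},\dots,\omega_{1,p},\omega_{2,1},\dots,\omega_{2,q}$ be functions without zeros on $\mathcal X$, and let $n\in\mathbb Z_{\ge0}^p$, $m\in\mathbb Z_{\ge0}^q$ with $N=\sum n_i=\sum m_j$. Let $\phi_1,\dots,\phi_N$ enumerate the functions $\omega_{1,i}(x)x^k$ ($0\le k<n_i$), let $\psi_1,\dots,\psi_N$ enumerate $\omega_{2,j}(x)x^k$ ($0\le k<m_j$), put $F(x_1,\dots,x_N)=\det[\phi_i(x_j)]\det[\psi_i(x_j)]$, and assume $Z=\sum_{x_1,\dots,x_N\in\mathcal X}F\neq0$. Suppose there are rational functions $\varpi_{1,i},\varpi_{2,j}$ with $\omega_{1,i}(x+1)/\omega_{1,i}(x)=\varpi_{1,i}(x)$ and $\omega_{2,j}(x+1)/\omega_{2,j}(x)=\varpi_{2,j}(x)$ whenever $x,x+1\in\mathcal X$. For $\mathcal Y\subset\mathcal X$ let $\mathcal L_{\mathcal Y}$ be the following bundle of rank $p+q$ on $\mathbb P^1$: away from $\mathcal Y$ it is $\bigoplus_i\mathcal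 O(n_i-1)\oplus\bigoplus_j\mathcal O(-m_j-1)$; near $y\in\mathcal Y$ its sections are the rational $s=(s_{1,i};s_{2,j})$ with $s_{1,i}$ regular, $s_{2,j}$ having at most a first order pole, and $\operatorname{res}_y s_{2,j}=\omega_{2,j}(y)\sum_i\omega_{1,i}(y)s_{1,i}(y)$. Let $\mathcal A(z)=\operatorname{diag}(1/\varpi_{1,1},\dots,1/\varpi_{1,p},\varpi_{2,1},\dots,\varpi_{2,q})$. A configuration $c=(\mathbf a,\mathbf b)=(a_1,\dots,a_r;b_1,\dots,b_r)$ is admissible if each $b_i-a_i$ is a positive integer and the sets $\{a_i,a_i+1,\dots,b_i\}$ are pairwise disjoint subsets of $\mathcal X$. Let $\mathcal Y_c$ be the complement of their union in $\mathcal X$, and $D(c)=D(\mathbf a,\mathbf b)=\frac1Z\sum_{x_1,\dots,x_N\in\mathcal Y_c}F(x_1,\dots,x_N)$. To an endpoint $e$ attach the point $u_e=b_i$ and the outer neighbour $b_i+1$ if $e=b_i$, and the point $u_e=a_i-1$ and the outer neighbour $a_i-1$ if $e=a_i$. For a sign $\sigma=\pm1$ let $c+\sigma e$ be $c$ with the endpoint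 $e$ changed by $\sigma$, and let $x=u_e+1$ if $\sigma=1$, $x=u_e$ if $\sigma=-1$. Given a square matrix $A(z)$ of rational functions, a *triple* for $(e,\sigma)$ consists of vectors $(w,w',w'')$ such that, with $B=A$ if $\sigma=1$ and $B=A^{-1}$ if $\sigma=-1$: $w$ is a basis of the image of $\operatorname{res}_{u_e}B$; $\langle w,w'\rangle=0$; $w'\ne0$; and $B^t(z)(w'+w''(z-u_e))$ vanishes at $z=u_e$. **Theorem.** Let $c$ be admissible, suppose that $\mathcal L_{\mathcal Y_c}\simeq\mathcal O(-1)^{p+q}$, and let $A(z)=T(z+1)\mathcal A(z)T(z)^{-1}$ be the matrix of $\mathcal A$ corresponding to a choice $T$ of such an isomorphism. Then $D(\mathbf a,\mathbf b)$ is a $\tau$-function of $A(z)$ in the following sense. 1. Let $e$ be an endpoint whose outer neighbour lies in $\mathcal Y_c$. Then $A$ has at most a first order pole at $u_e$, its residue there has rank $1$, and $\det A$ is regular and nonzero at $u_e$. For each $\sigma$ a triple for $(e,\sigma)$ exists; and if $c+\sigma e$ is admissible, then for every such triple $\langle w,w''\rangle\neq0$ if and only if $D(c+\sigma e)\ne0$,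 and in this case $\left(I+\frac{w\,(w')^t}{\langle w,w''\rangle(z-x)}\right)T(z)$ is an isomorphism $\mathcal L_{\mathcal Y_{c+\sigma e}}\simeq\mathcal O(-1)^{p+q}$. 2. Let $e,f$ be endpoints and $\sigma,\rho$ signs such that the outer neighbour of $e$ lies in $\mathcal Y_c$, the configurations $c+\sigma e$, $c+\rho f$, $c+\sigma e+\rho f$ are admissible, and $D(c+\sigma e)$, $D(c+\rho f)$ are nonzero. Then $\mathcal L_{\mathcal Y_{c+\rho f}}\simeq\mathcal O(-1)^{p+q}$, and for every isomorphism $T'$ of this kind and every triple for $(e,\sigma)$ we have $\langle w,w''\rangle\ne0$ and $$\frac{D(c+\sigma e+\rho f)\,D(c)}{D(c+\sigma e)\,D(c+\rho f)}=\frac{\langle\tilde w,\tilde w''\rangle}{\langle w,w''\rangle},\qquad \tilde w=G(x)w,\quad \tilde w''=G^{-t}(x)w''+\frac{dG^{-t}}{dz}(x)\,w',$$ where, with $R=T'T^{-1}$, $G(z)=R(z)$ if $f\ne e$, $G(z)=R(z+1)A(z)$ if $f=e$ and $\rho=1$, and $G(z)=R(z-1)A(z-1)^{-1}$ if $f=e$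 and $\rho=-1$. In particular ($\sigma=\rho=1$) this computes the second difference logarithmic derivatives of $D$ in $\mathbf b$, those in $\mathbf a$ (for endpoints $a_i$ with $a_i-1\in\mathcal Y_c$), and the mixed ones. -/

import Mathlib

noncomputable section

open Matrix

/-! ### Rational functions of one complex variable -/

/-- The value of a rational function at a point (meaningful where it is regular). -/
def ratVal (z : ℂ) (f : RatFunc ℂ) : ℂ := RatFunc.eval (RingHom.id ℂ) z f

/-- `f` has no pole at the finite point `z`. -/
def RegularAt (z : ℂ) (f : RatFunc ℂ) : Prop := f.denom.eval z ≠ 0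

/-- `f` is regular at `z` with value `0`. -/
def VanishesAt (z : ℂ) (f : RatFunc ℂ) : Prop := RegularAt z f ∧ ratVal z f = 0

/-- The local parameter `X - z`. -/
def localParam (z : ℂ) : RatFunc ℂ := RatFunc.X - RatFunc.C z

/-- `f` has at most a first order pole at `z`. -/
def AtMostSimplePole (z : ℂ) (f : RatFunc ℂ) : Prop := RegularAt z (localParam z * f)

/-- The residue of `f` at `z` (meaningful if `f` has at most a first order pole there). -/
def simpleRes (z : ℂ) (f : RatFunc ℂ) : ℂ := ratVal z (localParam z * f)

/-- `f` is a section of `O(d)` near infinity: it grows at most like `X ^ d`. -/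
def DegLE (d : ℤ) (f : RatFunc ℂ) : Prop := f = 0 ∨ f.intDegree ≤ d

/-- The substitution `f(z) ↦ f(z + h)`. -/
def shift (h : ℂ) : RatFunc ℂ →+* RatFunc ℂ :=
  RatFunc.mapRingHom (Polynomial.taylorEquiv h)
    (nonZeroDivisors_le_comap_nonZeroDivisors_of_injective _ (Polynomial.taylorEquiv h).injective)

/-- Entrywise value of a matrix of rational functions. -/
def matVal {ι : Type} (z : ℂ) (M : Matrix ι ι (RatFunc ℂ)) : Matrix ι ι ℂ := M.map (ratVal z)

/-- Entrywise derivative `dM/dz` of a matrix of rational functions at a point of regularity. -/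
def matDeriv {ι : Type} (z : ℂ) (M : Matrix ι ι (RatFunc ℂ)) : Matrix ι ι ℂ :=
  M.map fun f => deriv (fun t => ratVal t f) z

/-- Entrywise residue of a matrix whose entries have at most first order poles. -/
def matRes {ι : Type} (z : ℂ) (M : Matrix ι ι (RatFunc ℂ)) : Matrix ι ι ℂ := M.map (simpleRes z)

/-! ### Matrices `A(z)` of d-connections, their singularities, and the triples `(w, w', w'')` -/

/-- The singularity structure: at `u` the entries of `A(z)` have at most first order poles, the
residue of `A(z)` has rank one, and `det A(z)` is regular and nonzero. -/
def HasSingularity {ι : Type} [Fintype ι] [DecidableEq ι]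
    (A : Matrix ι ι (RatFunc ℂ)) (u : ℂ) : Prop :=
  (∀ i j, AtMostSimplePole u (A i j)) ∧ (matRes u A).rank = 1 ∧
    RegularAt u A.det ∧ ratVal u A.det ≠ 0

/-- The direction in which a singular point is moved: `u ↦ u + 1` or `u ↦ u - 1`. -/
inductive Dir
  | up
  | down

/-- The corresponding increment. -/
def Dir.val : Dir → ℂ
  | .up => 1
  | .down => -1

/-- A vector `w` together with the functional `w' + w'' (z - x)`. -/
structure Triple (ι : Type) where
  w : ι → ℂ
  w' : ι → ℂ
  w'' : ι → ℂ

/-- The matrix which is singular at `u` and whose values lie in the fibre that is modified when the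
singularity at `u` is moved: `A⁻¹ : L_{z+1} → L_z` if it is moved to `u - 1` (the bundle is
modified at `u`), and `A : L_z → L_{z+1}` if it is moved to `u + 1` (the bundle is modified at
`u + 1`). -/
def Dir.singularMatrix {ι : Type} [Fintype ι] [DecidableEq ι] (A : Matrix ι ι (RatFunc ℂ)) :
    Dir → Matrix ι ι (RatFunc ℂ)
  | .up => A
  | .down => A⁻¹

/-- `(w, w', w'')` is an admissible choice for moving the singularity of `A(z)` at `u` in
direction `d`. Writing `B` for `A⁻¹` (move to `u - 1`) or `A` (move to `u + 1`): `w` is a basis of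
the image of the residue of `B` at `u`, `⟨w, w'⟩ = 0`, `w' ≠ 0`, and
`Bᵗ(z) (w' + w'' (z - u))` vanishes at `z = u`. -/
def IsTriple {ι : Type} [Fintype ι] [DecidableEq ι]
    (A : Matrix ι ι (RatFunc ℂ)) (u : ℂ) (d : Dir) (τ : Triple ι) : Prop :=
  τ.w ≠ 0 ∧
  LinearMap.range (matRes u (d.singularMatrix A)).mulVecLin = Submodule.span ℂ {τ.w} ∧
  τ.w ⬝ᵥ τ.w' = 0 ∧
  τ.w' ≠ 0 ∧
  ∀ k, VanishesAt u (((d.singularMatrix A)ᵀ *ᵥ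
    fun i => RatFunc.C (τ.w' i) + RatFunc.C (τ.w'' i) * localParam u) k)

/-- The number `⟨w, w''⟩`, the first difference logarithmic derivative of `τ`. -/
def Triple.pairing {ι : Type} [Fintype ι] (τ : Triple ι) : ℂ := τ.w ⬝ᵥ τ.w''

/-- The elementary gauge matrix `R(z) = I + w (w')ᵗ / (⟨w, w''⟩ (z - x))`. -/
def Triple.gauge {ι : Type} [Fintype ι] [DecidableEq ι] (τ : Triple ι) (x : ℂ) :
    Matrix ι ι (RatFunc ℂ) :=
  1 + (localParam x)⁻¹ • (τ.pairing⁻¹ • vecMulVec τ.w τ.w').map RatFunc.C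

/-- The triple `(w, w', w'')` at `z = x` carried over by an isomorphism `G(z)` that is regular and
invertible at `z = x`: `G w`, `G⁻ᵗ w'` and `G⁻ᵗ w'' + (dG⁻ᵗ/dz) w'`, all taken at `z = x`. -/
def Triple.transport {ι : Type} [Fintype ι] [DecidableEq ι] (τ : Triple ι)
    (G : Matrix ι ι (RatFunc ℂ)) (x : ℂ) : Triple ι where
  w := matVal x G *ᵥ τ.w
  w' := (matVal x G⁻¹)ᵀ *ᵥ τ.w'
  w'' := (matVal x G⁻¹)ᵀ *ᵥ τ.w'' + (matDeriv x G⁻¹)ᵀ *ᵥ τ.w'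

/-! ### The biorthogonal ensemble -/

/-- The phase space `X`, the nonvanishing weights `ω₁,₁, …, ω₁,ₚ`, `ω₂,₁, …, ω₂,_q`, the
multi-indices `n`, `m`, and enumerations of the functions `φ` and `ψ` by `1, …, N` (which exist
exactly when `N = ∑ nᵢ = ∑ mᵢ`). Only the values of the weights on `X` are used. -/
structure Ensemble (p q N : ℕ) where
  X : Finset ℂ
  ω₁ : Fin p → ℂ → ℂ
  ω₂ : Fin q → ℂ → ℂ
  ω₁_ne_zero : ∀ i, ∀ x ∈ X, ω₁ i x ≠ 0
  ω₂_ne_zero : ∀ i, ∀ x ∈ X, ω₂ i x ≠ 0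
  n : Fin p → ℕ
  m : Fin q → ℕ
  enumφ : Fin N ≃ (i : Fin p) × Fin (n i)
  enumψ : Fin N ≃ (i : Fin q) × Fin (m i)

namespace Ensemble

variable {p q N : ℕ} (E : Ensemble p q N)

/-- The functions `ω₁,ᵢ(x) x ^ j`, `0 ≤ j < nᵢ`. -/
def φ (k : Fin N) (x : ℂ) : ℂ := E.ω₁ (E.enumφ k).1 x * x ^ ((E.enumφ k).2 : ℕ)

/-- The functions `ω₂,ᵢ(x) x ^ j`, `0 ≤ j < mᵢ`. -/
def ψ (k : Fin N) (x : ℂ) : ℂ := E.ω₂ (E.enumψ k).1 x * x ^ ((E.enumψ k).2 : ℕ)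

/-- `F(x₁, …, x_N) = det[φᵢ(xⱼ)] det[ψᵢ(xⱼ)]`. -/
def F (x : Fin N → ℂ) : ℂ :=
  (Matrix.of fun i j => E.φ i (x j)).det * (Matrix.of fun i j => E.ψ i (x j)).det

/-- The sum of `F(x₁, …, x_N)` over `x₁, …, x_N ∈ Y`. -/
def partialSum (Y : Finset ℂ) : ℂ := ∑ x ∈ Fintype.piFinset (fun _ : Fin N => Y), E.F x

/-- `Z`, the sum over the whole phase space. -/
def Z : ℂ := E.partialSum E.X

/-! ### The bundles `L_Y`, described by their stalks inside the rational sections -/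

/-- `s` is a section of `L_Y` near the finite point `z`. -/
def IsSectionAt (Y : Finset ℂ) (z : ℂ) (s : Fin p ⊕ Fin q → RatFunc ℂ) : Prop :=
  (∀ i, RegularAt z (s (.inl i))) ∧
  (z ∉ Y → ∀ j, RegularAt z (s (.inr j))) ∧
  (z ∈ Y → ∀ j, AtMostSimplePole z (s (.inr j)) ∧
    simpleRes z (s (.inr j)) = E.ω₂ j z * ∑ i, E.ω₁ i z * ratVal z (s (.inl i)))

/-- `s` is a section of `L_Y` near infinity, where `L_Y` coincides with
`⨁ O(nᵢ - 1) ⊕ ⨁ O(-mⱼ - 1)`. -/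
def IsSectionAtInfty (s : Fin p ⊕ Fin q → RatFunc ℂ) : Prop :=
  (∀ i, DegLE ((E.n i : ℤ) - 1) (s (.inl i))) ∧ (∀ j, DegLE (-(E.m j : ℤ) - 1) (s (.inr j)))

/-- `T` is an isomorphism `L_Y ≃ O(-1) ^ (p + q)`: a rational isomorphism that identifies the
sections of the two bundles near every point of the projective line. -/
def IsTrivialization (Y : Finset ℂ)
    (T : Matrix (Fin p ⊕ Fin q) (Fin p ⊕ Fin q) (RatFunc ℂ)) : Prop :=
  IsUnit T.det ∧
  (∀ z s, E.IsSectionAt Y z s ↔ ∀ k, RegularAt z ((T *ᵥ s) k)) ∧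
  (∀ s, E.IsSectionAtInfty s ↔ ∀ k, DegLE (-1) ((T *ᵥ s) k))

end Ensemble

/-- The d-connection `diag(1/ϖ₁,₁, …, 1/ϖ₁,ₚ, ϖ₂,₁, …, ϖ₂,_q)`, acting on the rational sections. -/
def diagConnection {p q : ℕ} (ϖ₁ : Fin p → RatFunc ℂ) (ϖ₂ : Fin q → RatFunc ℂ) :
    Matrix (Fin p ⊕ Fin q) (Fin p ⊕ Fin q) (RatFunc ℂ) :=
  Matrix.diagonal (Sum.elim (fun i => (ϖ₁ i)⁻¹) ϖ₂)

/-- The matrix `T(z + 1) 𝒜(z) T(z)⁻¹` of the d-connection `𝒜` in the trivialization `T`. -/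
def connectionMatrix {ι : Type} [Fintype ι] [DecidableEq ι] (𝒜 T : Matrix ι ι (RatFunc ℂ)) :
    Matrix ι ι (RatFunc ℂ) :=
  T.map (shift 1) * 𝒜 * T⁻¹

/-! ### Integral segments and their endpoints -/

/-- The endpoints of `r` segments: `Sum.inl i` labels `aᵢ` and `Sum.inr i` labels `bᵢ`. A
configuration `c` of endpoints stands for `a = c ∘ Sum.inl` and `b = c ∘ Sum.inr`. -/
abbrev Endpoint (r : ℕ) : Type := Fin r ⊕ Fin r

/-- The set `{a, a + 1, …, b}`. -/
def integralSegment (a b : ℂ) : Set ℂ := {z | ∃ j k : ℕ, z = a + j ∧ b = z + k}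

/-- The configuration obtained from `c` by adding `1` or `-1` to one endpoint. -/
def move {r : ℕ} (c : Endpoint r → ℂ) (e : Endpoint r) (d : Dir) : Endpoint r → ℂ :=
  c + Pi.single e d.val

/-- The singular point of the d-connection attached to an endpoint: `aᵢ - 1`, resp. `bᵢ`. -/
def singularPoint {r : ℕ} (c : Endpoint r → ℂ) : Endpoint r → ℂ
  | .inl i => c (.inl i) - 1
  | .inr i => c (.inr i)

/-- The neighbour of an endpoint outside of its segment: `aᵢ - 1`, resp. `bᵢ + 1`. -/
def outerNeighbour {r : ℕ} (c : Endpoint r → ℂ) : Endpoint r → ℂ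
  | .inl i => c (.inl i) - 1
  | .inr i => c (.inr i) + 1

/-- The point at which the bundle is modified when an endpoint, hence the attached singular point
`u`, is moved: `u + 1` if it is moved up, `u` if it is moved down. -/
def modifiedPoint {r : ℕ} (c : Endpoint r → ℂ) (e : Endpoint r) : Dir → ℂ
  | .up => singularPoint c e + 1
  | .down => singularPoint c e

/-- The isomorphism along which the triples of the endpoint `e` are carried over when the endpoint
`f` is moved in direction `d`. Here `A` is the matrix before the move and `R` is the gauge matrix of
the move. If `f ≠ e` it is `R(z)`. If `f = e` the singular point itself moves by one, and the
isomorphism is `R(z + 1) A(z)`, resp. `R(z - 1) A(z - 1)⁻¹`. -/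
def transportMatrix {ι : Type} [Fintype ι] [DecidableEq ι] {r : ℕ}
    (A R : Matrix ι ι (RatFunc ℂ)) (e f : Endpoint r) (d : Dir) : Matrix ι ι (RatFunc ℂ) :=
  if e = f then
    match d with
    | .up => R.map (shift 1) * A
    | .down => (R * A⁻¹).map (shift (-1))
  else R

namespace Ensemble

variable {p q N : ℕ} (E : Ensemble p q N)

/-- The `[aᵢ, bᵢ]` are integral segments, `bᵢ - aᵢ` being a positive integer; they are contained in
the phase space and do not intersect. -/
def Admissible {r : ℕ} (c : Endpoint r → ℂ) : Prop :=
  (∀ i, ∃ k : ℕ, 0 < k ∧ c (.inr i) - c (.inl i) = k) ∧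
  (∀ i, integralSegment (c (.inl i)) (c (.inr i)) ⊆ (E.X : Set ℂ)) ∧
  (∀ i j, i ≠ j → Disjoint (integralSegment (c (.inl i)) (c (.inr i)))
    (integralSegment (c (.inl j)) (c (.inr j))))

open Classical in
/-- The complement `Y` in the phase space of the union of the segments. -/
def complement {r : ℕ} (c : Endpoint r → ℂ) : Finset ℂ :=
  E.X.filter fun x => ∀ i, x ∉ integralSegment (c (.inl i)) (c (.inr i))

/-- The gap probability `D(a, b)`. -/
def D {r : ℕ} (c : Endpoint r → ℂ) : ℂ := E.partialSum (E.complement c) / E.Z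

end Ensemble

end

/-!
# The gap probability of a biorthogonal ensemble as a `τ`-function

Everything is local linear algebra around a single kind of bundle modification.

*Frames.* With `b = (0; ω₂(z))` and `a = (ω₁(z); 0)`, the sections of `L_Y` near `z` are
`(I + c b aᵗ / (X - z)) v` with `v` regular, where `c = 1` for `z ∈ Y` and `c = 0` otherwise
(`Ensemble.isSectionAt_iff`). A trivialization `T` multiplied by this frame is therefore a regular
invertible matrix `S` near `z`, and adding `z` to `Y` or removing it multiplies `S` on the right by
`I + ε b aᵗ / (X - z)` with `ε = ±1`. The data `(w, w', w'')` of such a modification, up to what is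
irrelevant, are multiples `w = r S(z) b`, `w' = s S(z)⁻ᵗ a` and the value of `⟨w, w''⟩`, which is
determined by the first order expansion of `S` (`IsModTriple`).

*Triples of `A`.* At a singular point `u` the matrix `A = T(z + 1) 𝒜(z) T(z)⁻¹`, and likewise its
inverse, is a product of regular invertible matrices and one factor `I + ε b aᵗ / (X - u)`. Its
triples are exactly the triples of the modification at `u + 1`, resp. at `u`
(`isTriple_iff`, `Ensemble.IsTrivialization.singularity`).

*Partition functions.* By the Andréief identity the sum of `F` over `Y` is `N!` times the
determinant of the matrix `G = ∑_{y ∈ Y} ψ(y) φ(y)ᵗ` (`Ensemble.partialSum_eq`). A vector in the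
kernel of `G` gives a global section of `L_Y`, so this determinant does not vanish if `L_Y` is
trivialized. Toggling the point `x` multiplies it by `1 + ε φ(x)ᵗ G⁻¹ ψ(x)`. The vector `G⁻¹ ψ(x)`
gives a global section of `L_Y` with one additional simple pole at `x`; in the trivialization its
components are `O(1 / X)` with a single known polar part, hence known. Evaluating it shows that the
factor is `-ε ⟨w, w''⟩ / (r s)` (`Ensemble.IsTrivialization.partialSum_toggle`). This gives the
criterion `⟨w, w''⟩ ≠ 0`, and a direct computation shows that the gauge matrix then trivializes the
modified bundle (`IsModTriple.localIso_gauge`).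

*Second differences.* The transport of triples along `G` is the change of frame from `S` to `G S`
(`IsModTriple.transport`), with the same `r`, `s` and `ε`. For different endpoints, as well as for a
repeated move of one endpoint, where `𝒜` carries the vectors `b` and `a` at `x` to those at the
neighbouring point, the transported triple is a triple of the same move made after the move of the
other endpoint (`Ensemble.IsTrivialization.transport`,
`Ensemble.IsTrivialization.transport_shift`). The unknown factor `-ε / (r s)` cancels in the ratio.
-/

noncomputable section

open Matrix

/-! ### Germs of rational functions at a point -/

section Germs

variable {z : ℂ} {f g : RatFunc ℂ}

theorem ratVal_eq_div (z : ℂ) (f : RatFunc ℂ) :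
    ratVal z f = f.num.eval z / f.denom.eval z := rfl

theorem regularAt_of_denom_dvd {d : Polynomial ℂ} (h : f.denom ∣ d) (hd : d.eval z ≠ 0) :
    RegularAt z f := by
  obtain ⟨e, rfl⟩ := h
  intro h0
  exact hd (by simp [h0])

theorem RegularAt.add (hf : RegularAt z f) (hg : RegularAt z g) : RegularAt z (f + g) :=
  regularAt_of_denom_dvd (RatFunc.denom_add_dvd f g) (by
    rw [Polynomial.eval_mul]; exact mul_ne_zero hf hg)

theorem RegularAt.mul (hf : RegularAt z f) (hg : RegularAt z g) : RegularAt z (f * g) :=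
  regularAt_of_denom_dvd (RatFunc.denom_mul_dvd f g) (by
    rw [Polynomial.eval_mul]; exact mul_ne_zero hf hg)

theorem regularAt_algebraMap (p : Polynomial ℂ) :
    RegularAt z (algebraMap (Polynomial ℂ) (RatFunc ℂ) p) := by
  simp [RegularAt, RatFunc.denom_algebraMap]

theorem regularAt_C (a : ℂ) : RegularAt z (RatFunc.C a) := by
  simp [RegularAt, RatFunc.denom_C]

theorem regularAt_zero : RegularAt z 0 := by simp [RegularAt, RatFunc.denom_zero]

theorem regularAt_one : RegularAt z 1 := by simp [RegularAt, RatFunc.denom_one]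

theorem RegularAt.neg (hf : RegularAt z f) : RegularAt z (-f) := by
  have := (regularAt_C (z := z) (-1)).mul hf
  simpa using this

theorem RegularAt.sub (hf : RegularAt z f) (hg : RegularAt z g) : RegularAt z (f - g) := by
  rw [sub_eq_add_neg]; exact hf.add hg.neg

theorem localParam_eq_algebraMap (z : ℂ) : localParam z =
    algebraMap (Polynomial ℂ) (RatFunc ℂ) (Polynomial.X - Polynomial.C z) := by
  simp [localParam, RatFunc.algebraMap_X, RatFunc.algebraMap_C]

theorem regularAt_localParam (z x : ℂ) : RegularAt z (localParam x) := by
  rw [localParam_eq_algebraMap]; exact regularAt_algebraMap _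

theorem localParam_ne_zero (z : ℂ) : localParam z ≠ 0 := by
  rw [localParam_eq_algebraMap]
  exact RatFunc.algebraMap_ne_zero (Polynomial.X_sub_C_ne_zero z)

theorem regularAt_sum {κ : Type*} (s : Finset κ) (F : κ → RatFunc ℂ)
    (h : ∀ k ∈ s, RegularAt z (F k)) : RegularAt z (∑ k ∈ s, F k) :=
  Finset.sum_induction F (RegularAt z) (fun _ _ => RegularAt.add) regularAt_zero h

theorem regularAt_prod {κ : Type*} (s : Finset κ) (F : κ → RatFunc ℂ)
    (h : ∀ k ∈ s, RegularAt z (F k)) : RegularAt z (∏ k ∈ s, F k) :=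
  Finset.prod_induction F (RegularAt z) (fun _ _ => RegularAt.mul) regularAt_one h

theorem ratVal_add (hf : RegularAt z f) (hg : RegularAt z g) :
    ratVal z (f + g) = ratVal z f + ratVal z g := RatFunc.eval_add _ _ hf hg

theorem ratVal_mul (hf : RegularAt z f) (hg : RegularAt z g) :
    ratVal z (f * g) = ratVal z f * ratVal z g := RatFunc.eval_mul _ _ hf hg

@[simp] theorem ratVal_C (z a : ℂ) : ratVal z (RatFunc.C a) = a := by simp [ratVal]

@[simp] theorem ratVal_zero (z : ℂ) : ratVal z 0 = 0 := by simp [ratVal]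

@[simp] theorem ratVal_one (z : ℂ) : ratVal z 1 = 1 := by simp [ratVal]

theorem ratVal_algebraMap (z : ℂ) (p : Polynomial ℂ) :
    ratVal z (algebraMap (Polynomial ℂ) (RatFunc ℂ) p) = p.eval z := by
  rw [ratVal, RatFunc.eval_algebraMap]; simp [Polynomial.eval₂_id]

@[simp] theorem ratVal_localParam (z x : ℂ) : ratVal z (localParam x) = z - x := by
  rw [localParam_eq_algebraMap, ratVal_algebraMap]; simp

theorem ratVal_neg (hf : RegularAt z f) : ratVal z (-f) = -ratVal z f := by
  have := ratVal_mul (regularAt_C (z := z) (-1)) hf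
  rwa [ratVal_C, map_neg, map_one, neg_one_mul, neg_one_mul] at this

theorem ratVal_sub (hf : RegularAt z f) (hg : RegularAt z g) :
    ratVal z (f - g) = ratVal z f - ratVal z g := by
  rw [sub_eq_add_neg, ratVal_add hf hg.neg, ratVal_neg hg, sub_eq_add_neg]

theorem ratVal_sum {κ : Type*} (s : Finset κ) (F : κ → RatFunc ℂ)
    (h : ∀ k ∈ s, RegularAt z (F k)) : ratVal z (∑ k ∈ s, F k) = ∑ k ∈ s, ratVal z (F k) := by
  classical
  induction s using Finset.induction_on with
  | empty => simp
  | insert a s ha ih =>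
    rw [Finset.sum_insert ha, Finset.sum_insert ha, ratVal_add (h a (by simp))
      (regularAt_sum _ _ fun k hk => h k (by simp [hk])), ih fun k hk => h k (by simp [hk])]

theorem ratVal_prod {κ : Type*} (s : Finset κ) (F : κ → RatFunc ℂ)
    (h : ∀ k ∈ s, RegularAt z (F k)) : ratVal z (∏ k ∈ s, F k) = ∏ k ∈ s, ratVal z (F k) := by
  classical
  induction s using Finset.induction_on with
  | empty => simp
  | insert a s ha ih =>
    rw [Finset.prod_insert ha, Finset.prod_insert ha, ratVal_mul (h a (by simp))
      (regularAt_prod _ _ fun k hk => h k (by simp [hk])), ih fun k hk => h k (by simp [hk])]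

theorem RegularAt.inv (hf : ratVal z f ≠ 0) : RegularAt z f⁻¹ := by
  have h0 : f ≠ 0 := by rintro rfl; simp at hf
  refine regularAt_of_denom_dvd (RatFunc.denom_inv_dvd h0) fun h => hf ?_
  rw [ratVal_eq_div, h, zero_div]

/-- At a pole the value is the junk value `0`. -/
theorem regularAt_of_ratVal_ne_zero (hf : ratVal z f ≠ 0) : RegularAt z f := by
  intro h
  exact hf (by rw [ratVal_eq_div, h, div_zero])

theorem ratVal_inv (hf : ratVal z f ≠ 0) : ratVal z f⁻¹ = (ratVal z f)⁻¹ := by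
  have h0 : f ≠ 0 := by rintro rfl; simp at hf
  have := ratVal_mul (regularAt_of_ratVal_ne_zero hf) (RegularAt.inv hf)
  rw [mul_inv_cancel₀ h0, ratVal_one] at this
  exact eq_inv_of_mul_eq_one_right this.symm

theorem regularAt_inv_localParam {x : ℂ} (h : z ≠ x) : RegularAt z (localParam x)⁻¹ :=
  RegularAt.inv (by simpa [sub_eq_zero] using h)

/-- A function that vanishes at `z` is divisible by the local parameter. -/
theorem RegularAt.div_localParam (hf : RegularAt z f) (h0 : ratVal z f = 0) :
    RegularAt z ((localParam z)⁻¹ * f) := by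
  have hn : f.num.eval z = 0 := by
    rw [ratVal_eq_div] at h0
    exact (div_eq_zero_iff.1 h0).resolve_right hf
  obtain ⟨p, hp⟩ := Polynomial.dvd_iff_isRoot.2 hn
  have hf' : (localParam z)⁻¹ * f = algebraMap (Polynomial ℂ) (RatFunc ℂ) p /
      algebraMap (Polynomial ℂ) (RatFunc ℂ) f.denom := by
    conv_lhs => rw [← RatFunc.num_div_denom f, hp, map_mul, ← localParam_eq_algebraMap]
    have := localParam_ne_zero z
    field_simp
  rw [hf']
  exact regularAt_of_denom_dvd (RatFunc.denom_div_dvd _ _) hf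

theorem RegularAt.exists_eq_add (hf : RegularAt z f) :
    ∃ g, RegularAt z g ∧ f = RatFunc.C (ratVal z f) + localParam z * g := by
  refine ⟨_, (hf.sub (regularAt_C (ratVal z f))).div_localParam ?_, ?_⟩
  · rw [ratVal_sub hf (regularAt_C _)]; simp
  · rw [mul_inv_cancel_left₀ (localParam_ne_zero z)]; ring

/-- The value of `df/dz` at `z`, meaningful if `f` is regular there. -/
def ratDeriv (z : ℂ) (f : RatFunc ℂ) : ℂ := deriv (fun t => ratVal t f) z

theorem RegularAt.eventually (hf : RegularAt z f) : ∀ᶠ t in nhds z, RegularAt t f :=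
  f.denom.continuous.continuousAt.eventually_ne hf

theorem RegularAt.differentiableAt (hf : RegularAt z f) :
    DifferentiableAt ℂ (fun t => ratVal t f) z :=
  f.num.differentiable.differentiableAt.fun_div f.denom.differentiable.differentiableAt hf

theorem ratDeriv_add (hf : RegularAt z f) (hg : RegularAt z g) :
    ratDeriv z (f + g) = ratDeriv z f + ratDeriv z g := by
  rw [ratDeriv, ratDeriv, ratDeriv, ← deriv_fun_add hf.differentiableAt hg.differentiableAt]
  apply Filter.EventuallyEq.deriv_eq
  filter_upwards [hf.eventually, hg.eventually] with t h1 h2 using ratVal_add h1 h2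

theorem ratDeriv_mul (hf : RegularAt z f) (hg : RegularAt z g) :
    ratDeriv z (f * g) = ratDeriv z f * ratVal z g + ratVal z f * ratDeriv z g := by
  rw [ratDeriv, ratDeriv, ratDeriv, ← deriv_fun_mul hf.differentiableAt hg.differentiableAt]
  apply Filter.EventuallyEq.deriv_eq
  filter_upwards [hf.eventually, hg.eventually] with t h1 h2 using ratVal_mul h1 h2

@[simp] theorem ratDeriv_C (z a : ℂ) : ratDeriv z (RatFunc.C a) = 0 := by simp [ratDeriv]

@[simp] theorem ratDeriv_zero (z : ℂ) : ratDeriv z 0 = 0 := by simp [ratDeriv]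

@[simp] theorem ratDeriv_localParam (z x : ℂ) : ratDeriv z (localParam x) = 1 := by
  simp [ratDeriv]

theorem ratDeriv_sum {κ : Type*} (s : Finset κ) (F : κ → RatFunc ℂ)
    (h : ∀ k ∈ s, RegularAt z (F k)) : ratDeriv z (∑ k ∈ s, F k) = ∑ k ∈ s, ratDeriv z (F k) := by
  classical
  induction s using Finset.induction_on with
  | empty => simp
  | insert a s ha ih =>
    rw [Finset.sum_insert ha, Finset.sum_insert ha, ratDeriv_add (h a (by simp))
      (regularAt_sum _ _ fun k hk => h k (by simp [hk])), ih fun k hk => h k (by simp [hk])]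

theorem ratDeriv_localParam_mul (hf : RegularAt z f) :
    ratDeriv z (localParam z * f) = ratVal z f := by
  rw [ratDeriv_mul (regularAt_localParam z z) hf]; simp

end Germs

/-! ### Translations -/

section Shift

theorem shift_algebraMap (h : ℂ) (p : Polynomial ℂ) :
    shift h (algebraMap (Polynomial ℂ) (RatFunc ℂ) p) =
      algebraMap (Polynomial ℂ) (RatFunc ℂ) (Polynomial.taylor h p) := by
  have := RatFunc.map_apply_div (Polynomial.taylorEquiv h)
    (nonZeroDivisors_le_comap_nonZeroDivisors_of_injective _ (Polynomial.taylorEquiv h).injective)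
    p 1
  simp only [map_one, div_one] at this
  exact this

theorem shift_eq_div (h : ℂ) (f : RatFunc ℂ) : shift h f =
    algebraMap (Polynomial ℂ) (RatFunc ℂ) (Polynomial.taylor h f.num) /
      algebraMap (Polynomial ℂ) (RatFunc ℂ) (Polynomial.taylor h f.denom) := by
  conv_lhs => rw [← RatFunc.num_div_denom f]
  rw [map_div₀, shift_algebraMap, shift_algebraMap]

@[simp] theorem shift_C (h a : ℂ) : shift h (RatFunc.C a) = RatFunc.C a := by
  rw [← RatFunc.algebraMap_C, shift_algebraMap, Polynomial.taylor_C]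

theorem shift_localParam (h z : ℂ) : shift h (localParam (z + h)) = localParam z := by
  rw [localParam_eq_algebraMap, shift_algebraMap, localParam_eq_algebraMap]
  congr 1
  simp [Polynomial.taylor_X, Polynomial.taylor_C]

theorem regularAt_shift {h z : ℂ} {f : RatFunc ℂ} (hf : RegularAt (z + h) f) :
    RegularAt z (shift h f) := by
  rw [shift_eq_div]
  refine regularAt_of_denom_dvd (RatFunc.denom_div_dvd _ _) ?_
  rw [Polynomial.taylor_eval]; exact hf

theorem ratVal_shift {h z : ℂ} {f : RatFunc ℂ} (hf : RegularAt (z + h) f) :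
    ratVal z (shift h f) = ratVal (z + h) f := by
  have h1 : ratVal z (algebraMap (Polynomial ℂ) (RatFunc ℂ) (Polynomial.taylor h f.denom)) ≠ 0 := by
    rw [ratVal_algebraMap, Polynomial.taylor_eval]; exact hf
  rw [shift_eq_div, div_eq_mul_inv, ratVal_mul (regularAt_algebraMap _) (RegularAt.inv h1),
    ratVal_inv h1, ratVal_algebraMap, ratVal_algebraMap, Polynomial.taylor_eval,
    Polynomial.taylor_eval, ratVal_eq_div, div_eq_mul_inv]

theorem ratDeriv_shift {h z : ℂ} {f : RatFunc ℂ} (hf : RegularAt (z + h) f) :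
    ratDeriv z (shift h f) = ratDeriv (z + h) f := by
  rw [ratDeriv, ratDeriv, ← deriv_comp_add_const]
  apply Filter.EventuallyEq.deriv_eq
  have : Filter.Tendsto (fun t : ℂ => t + h) (nhds z) (nhds (z + h)) :=
    (continuous_id.add continuous_const).tendsto z
  filter_upwards [this.eventually hf.eventually] with t ht using ratVal_shift ht

theorem shift_shift_of_add_eq_zero {h k : ℂ} (hk : h + k = 0) (f : RatFunc ℂ) :
    shift h (shift k f) = f := by
  rw [shift_eq_div k, map_div₀, shift_algebraMap, shift_algebraMap, Polynomial.taylor_taylor,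
    Polynomial.taylor_taylor, hk]
  simp [RatFunc.num_div_denom]

end Shift

/-! ### Sections of line bundles at infinity -/

section Degree

theorem DegLE.add {d : ℤ} {f g : RatFunc ℂ} (hf : DegLE d f) (hg : DegLE d g) :
    DegLE d (f + g) := by
  rcases hf with rfl | hf
  · simpa using hg
  by_cases hg0 : g = 0
  · subst hg0; right; simpa using hf
  by_cases h : f + g = 0
  · exact Or.inl h
  exact Or.inr ((RatFunc.intDegree_add_le hg0 h).trans (max_le hf (hg.resolve_left hg0)))

theorem DegLE.mul {d e : ℤ} {f g : RatFunc ℂ} (hf : DegLE d f) (hg : DegLE e g) :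
    DegLE (d + e) (f * g) := by
  by_cases hf0 : f = 0
  · left; simp [hf0]
  by_cases hg0 : g = 0
  · left; simp [hg0]
  right
  rw [RatFunc.intDegree_mul hf0 hg0]
  exact add_le_add (hf.resolve_left hf0) (hg.resolve_left hg0)

theorem DegLE.mono {d e : ℤ} {f : RatFunc ℂ} (hf : DegLE d f) (h : d ≤ e) : DegLE e f :=
  hf.imp_right fun h' => h'.trans h

theorem degLE_C (a : ℂ) : DegLE 0 (RatFunc.C a) := Or.inr (by simp)

theorem degLE_zero (d : ℤ) : DegLE d 0 := Or.inl rfl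

theorem degLE_sum {d : ℤ} {κ : Type*} (s : Finset κ) (F : κ → RatFunc ℂ)
    (h : ∀ k ∈ s, DegLE d (F k)) : DegLE d (∑ k ∈ s, F k) :=
  Finset.sum_induction F (DegLE d) (fun _ _ => DegLE.add) (degLE_zero d) h

theorem intDegree_localParam (z : ℂ) : (localParam z).intDegree = 1 := by
  rw [localParam_eq_algebraMap, RatFunc.intDegree_polynomial]; simp

theorem degLE_inv_localParam (z : ℂ) : DegLE (-1) (localParam z)⁻¹ :=
  Or.inr (by rw [RatFunc.intDegree_inv, intDegree_localParam])

/-- `O(-1)` has no global sections. -/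
theorem eq_zero_of_regularAt_of_degLE {f : RatFunc ℂ} (hf : ∀ z, RegularAt z f)
    (h : DegLE (-1) f) : f = 0 := by
  refine h.resolve_right fun h' => ?_
  have hd : f.denom.natDegree = 0 := by
    by_contra hne
    obtain ⟨z, hz⟩ := IsAlgClosed.exists_root f.denom fun h0 =>
      hne (Polynomial.natDegree_eq_of_degree_eq_some h0)
    exact hf z hz
  rw [RatFunc.intDegree, hd] at h'
  omega

/-- A combination of simple fractions whose first `m` moments vanish is `O(X ^ (-m - 1))`. -/
theorem degLE_sum_simple_fractions (Y : Finset ℂ) (x : ℂ) (m : ℕ) :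
    ∀ (γ : ℂ → ℂ) (κ : ℂ), (∀ k < m, ∑ y ∈ Y, γ y * y ^ k + κ * x ^ k = 0) →
      DegLE (-(m : ℤ) - 1) (∑ y ∈ Y, RatFunc.C (γ y) * (localParam y)⁻¹ +
        RatFunc.C κ * (localParam x)⁻¹) := by
  induction m with
  | zero =>
    intro γ κ _
    refine (degLE_sum _ _ fun y _ => ?_).add ?_
    · simpa using (degLE_C (γ y)).mul (degLE_inv_localParam y)
    · simpa using (degLE_C κ).mul (degLE_inv_localParam x)
  | succ m ih =>
    intro γ κ h
    -- the moments of `X * f` are those of `f`, shifted by one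
    have h1 := ih (fun y => γ y * y) (κ * x) fun k hk => by
      rw [← h (k + 1) (by omega)]
      congr 1
      · exact Finset.sum_congr rfl fun y _ => by ring
      · ring
    have h0 : RatFunc.C (∑ y ∈ Y, γ y + κ) = (0 : RatFunc ℂ) := by
      rw [← map_zero RatFunc.C]; congr 1; simpa using h 0 (by omega)
    have key : ∀ c y : ℂ, RatFunc.X * (RatFunc.C c * (localParam y)⁻¹) =
        RatFunc.C c + RatFunc.C (c * y) * (localParam y)⁻¹ := by
      intro c y
      have := localParam_ne_zero y
      rw [map_mul]
      field_simp
      rw [localParam]; ring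
    set f := ∑ y ∈ Y, RatFunc.C (γ y) * (localParam y)⁻¹ + RatFunc.C κ * (localParam x)⁻¹
    have hX : RatFunc.X * f = ∑ y ∈ Y, RatFunc.C (γ y * y) * (localParam y)⁻¹ +
        RatFunc.C (κ * x) * (localParam x)⁻¹ := by
      rw [mul_add, Finset.mul_sum, key, Finset.sum_congr rfl fun y _ => key (γ y) y,
        Finset.sum_add_distrib]
      rw [map_add, map_sum] at h0
      linear_combination h0
    rw [← hX] at h1
    have hXinv : DegLE (-1) (RatFunc.X : RatFunc ℂ)⁻¹ :=
      Or.inr (by rw [RatFunc.intDegree_inv, RatFunc.intDegree_X])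
    have h2 := hXinv.mul h1
    rw [inv_mul_cancel_left₀ RatFunc.X_ne_zero] at h2
    exact h2.mono (by push_cast; omega)

end Degree

/-! ### Germs of matrices of rational functions -/

section MatrixGerms

variable {ι : Type} {z : ℂ}

/-- All entries of `M` are regular at `z`. -/
def MatRegular (z : ℂ) (M : Matrix ι ι (RatFunc ℂ)) : Prop := ∀ i j, RegularAt z (M i j)

variable {M P : Matrix ι ι (RatFunc ℂ)}

theorem MatRegular.transpose (hM : MatRegular z M) : MatRegular z Mᵀ := fun i j => hM j i

theorem matDeriv_apply (z : ℂ) (M : Matrix ι ι (RatFunc ℂ)) (i j : ι) :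
    matDeriv z M i j = ratDeriv z (M i j) := rfl

theorem matVal_transpose (z : ℂ) (M : Matrix ι ι (RatFunc ℂ)) :
    matVal z Mᵀ = (matVal z M)ᵀ := rfl

theorem MatRegular.add (hM : MatRegular z M) (hP : MatRegular z P) : MatRegular z (M + P) :=
  fun i j => (hM i j).add (hP i j)

theorem MatRegular.map_C (z : ℂ) (K : Matrix ι ι ℂ) : MatRegular z (K.map RatFunc.C) :=
  fun _ _ => regularAt_C _

theorem matVal_map_C (z : ℂ) (K : Matrix ι ι ℂ) : matVal z (K.map RatFunc.C) = K := by
  ext i j; simp [matVal]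

theorem matVal_add (hM : MatRegular z M) (hP : MatRegular z P) :
    matVal z (M + P) = matVal z M + matVal z P := by
  ext i j; exact ratVal_add (hM i j) (hP i j)

theorem matVal_shift {h : ℂ} (hM : MatRegular (z + h) M) :
    matVal z (M.map (shift h)) = matVal (z + h) M := by
  ext i j; exact ratVal_shift (hM i j)

theorem matDeriv_shift {h : ℂ} (hM : MatRegular (z + h) M) :
    matDeriv z (M.map (shift h)) = matDeriv (z + h) M := by
  ext i j; exact ratDeriv_shift (hM i j)

section One

variable [DecidableEq ι]

theorem matVal_one (z : ℂ) : matVal z (1 : Matrix ι ι (RatFunc ℂ)) = 1 := by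
  rw [← Matrix.map_one (RatFunc.C (K := ℂ)) (map_zero _) (map_one _), matVal_map_C]

theorem matDeriv_one (z : ℂ) : matDeriv z (1 : Matrix ι ι (RatFunc ℂ)) = 0 := by
  ext i j
  rw [matDeriv_apply, ← Matrix.map_one (RatFunc.C (K := ℂ)) (map_zero _) (map_one _)]
  simp

theorem MatRegular.one (z : ℂ) : MatRegular z (1 : Matrix ι ι (RatFunc ℂ)) := by
  rw [← Matrix.map_one (RatFunc.C (K := ℂ)) (map_zero _) (map_one _)]
  exact MatRegular.map_C z 1

end One

variable [Fintype ι]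

theorem MatRegular.mul (hM : MatRegular z M) (hP : MatRegular z P) : MatRegular z (M * P) :=
  fun i j => by
    rw [mul_apply]
    exact regularAt_sum _ _ fun k _ => (hM i k).mul (hP k j)

theorem matVal_mul (hM : MatRegular z M) (hP : MatRegular z P) :
    matVal z (M * P) = matVal z M * matVal z P := by
  ext i j
  simp only [matVal, map_apply, mul_apply]
  rw [ratVal_sum _ _ fun k _ => (hM i k).mul (hP k j)]
  exact Finset.sum_congr rfl fun k _ => ratVal_mul (hM i k) (hP k j)

theorem matDeriv_mul (hM : MatRegular z M) (hP : MatRegular z P) :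
    matDeriv z (M * P) = matDeriv z M * matVal z P + matVal z M * matDeriv z P := by
  ext i j
  rw [matDeriv_apply, mul_apply, ratDeriv_sum _ _ fun k _ => (hM i k).mul (hP k j),
    Matrix.add_apply,
    mul_apply, mul_apply, ← Finset.sum_add_distrib]
  exact Finset.sum_congr rfl fun k _ => ratDeriv_mul (hM i k) (hP k j)

theorem MatRegular.mulVec {v : ι → RatFunc ℂ} (hM : MatRegular z M) (hv : ∀ i, RegularAt z (v i))
    (i : ι) : RegularAt z ((M *ᵥ v) i) :=
  regularAt_sum _ _ fun k _ => (hM i k).mul (hv k)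

theorem ratVal_mulVec {v : ι → RatFunc ℂ} (hM : MatRegular z M) (hv : ∀ i, RegularAt z (v i))
    (i : ι) : ratVal z ((M *ᵥ v) i) = (matVal z M *ᵥ fun k => ratVal z (v k)) i := by
  simp only [Matrix.mulVec, dotProduct]
  rw [ratVal_sum _ _ fun k _ => (hM i k).mul (hv k)]
  exact Finset.sum_congr rfl fun k _ => ratVal_mul (hM i k) (hv k)

theorem ratDeriv_mulVec {v : ι → RatFunc ℂ} (hM : MatRegular z M) (hv : ∀ i, RegularAt z (v i))
    (i : ι) : ratDeriv z ((M *ᵥ v) i) = (matDeriv z M *ᵥ fun k => ratVal z (v k)) i +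
      (matVal z M *ᵥ fun k => ratDeriv z (v k)) i := by
  simp only [Matrix.mulVec, dotProduct]
  rw [ratDeriv_sum _ _ fun k _ => (hM i k).mul (hv k), ← Finset.sum_add_distrib]
  exact Finset.sum_congr rfl fun k _ => ratDeriv_mul (hM i k) (hv k)

variable [DecidableEq ι]

theorem MatRegular.det (hM : MatRegular z M) :
    RegularAt z M.det ∧ ratVal z M.det = (matVal z M).det := by
  have h : ∀ σ : Equiv.Perm ι, RegularAt z
      (RatFunc.C (((Equiv.Perm.sign σ : ℤ) : ℂ)) * ∏ i, M (σ i) i) := fun σ =>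
    (regularAt_C _).mul (regularAt_prod _ _ fun i _ => hM _ _)
  have e : M.det = ∑ σ : Equiv.Perm ι,
      RatFunc.C (((Equiv.Perm.sign σ : ℤ) : ℂ)) * ∏ i, M (σ i) i := by
    rw [det_apply']; simp
  rw [e, det_apply', ratVal_sum _ _ fun σ _ => h σ]
  refine ⟨regularAt_sum _ _ fun σ _ => h σ, Finset.sum_congr rfl fun σ _ => ?_⟩
  rw [ratVal_mul (regularAt_C _) (regularAt_prod _ _ fun i _ => hM _ _), ratVal_C,
    ratVal_prod _ _ fun i _ => hM _ _]
  rfl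

/-- `M` is an automorphism of the germs at `z` of vectors of regular functions. -/
def LocalIso (z : ℂ) (M : Matrix ι ι (RatFunc ℂ)) : Prop :=
  MatRegular z M ∧ ratVal z M.det ≠ 0

theorem LocalIso.isUnit_det (hM : LocalIso z M) : IsUnit M.det :=
  isUnit_iff_ne_zero.2 fun h => hM.2 (by simp [h])

theorem LocalIso.mul (hM : LocalIso z M) (hP : LocalIso z P) : LocalIso z (M * P) :=
  ⟨hM.1.mul hP.1, by
    rw [det_mul, ratVal_mul hM.1.det.1 hP.1.det.1]; exact mul_ne_zero hM.2 hP.2⟩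

theorem LocalIso.transpose (hM : LocalIso z M) : LocalIso z Mᵀ :=
  ⟨hM.1.transpose, by rw [det_transpose]; exact hM.2⟩

theorem LocalIso.inv (hM : LocalIso z M) : LocalIso z M⁻¹ := by
  have hreg : MatRegular z M⁻¹ := fun i j => by
    rw [inv_def, Ring.inverse_eq_inv', Matrix.smul_apply, adjugate_apply, smul_eq_mul]
    refine (RegularAt.inv hM.2).mul (MatRegular.det fun k l => ?_).1
    rw [updateRow_apply]
    split_ifs
    · rw [Pi.single_apply]; split_ifs
      exacts [regularAt_one, regularAt_zero]
    · exact hM.1 k l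
  refine ⟨hreg, fun h => ?_⟩
  have h1 := ratVal_mul hM.1.det.1 hreg.det.1
  rw [← det_mul, mul_nonsing_inv _ hM.isUnit_det, det_one, h, mul_zero, ratVal_one] at h1
  exact one_ne_zero h1

theorem LocalIso.matVal_inv_mul (hM : LocalIso z M) : matVal z M⁻¹ * matVal z M = 1 := by
  rw [← matVal_mul hM.inv.1 hM.1, nonsing_inv_mul _ hM.isUnit_det, matVal_one]

theorem LocalIso.matVal_mul_inv (hM : LocalIso z M) : matVal z M * matVal z M⁻¹ = 1 := by
  rw [← matVal_mul hM.1 hM.inv.1, mul_nonsing_inv _ hM.isUnit_det, matVal_one]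

theorem LocalIso.regular_mulVec_iff (hM : LocalIso z M) (v : ι → RatFunc ℂ) :
    (∀ k, RegularAt z ((M *ᵥ v) k)) ↔ ∀ k, RegularAt z (v k) := by
  refine ⟨fun h => ?_, fun h => hM.1.mulVec h⟩
  have := hM.inv.1.mulVec h
  rwa [mulVec_mulVec, nonsing_inv_mul _ hM.isUnit_det, one_mulVec] at this

theorem LocalIso.vanishes_mulVec_iff (hM : LocalIso z M) (v : ι → RatFunc ℂ) :
    (∀ k, VanishesAt z ((M *ᵥ v) k)) ↔ ∀ k, VanishesAt z (v k) := by
  have key : ∀ {Q : Matrix ι ι (RatFunc ℂ)} {u : ι → RatFunc ℂ}, MatRegular z Q →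
      (∀ k, VanishesAt z (u k)) → ∀ k, VanishesAt z ((Q *ᵥ u) k) := fun hQ hu k => by
    refine ⟨hQ.mulVec (fun i => (hu i).1) k, ?_⟩
    rw [ratVal_mulVec hQ fun i => (hu i).1]
    simp only [mulVec, dotProduct, fun i => (hu i).2, mul_zero, Finset.sum_const_zero]
  refine ⟨fun h => ?_, key hM.1⟩
  have := key hM.inv.1 h
  rwa [mulVec_mulVec, nonsing_inv_mul _ hM.isUnit_det, one_mulVec] at this

/-- A rational automorphism that maps germs of regular vectors exactly onto such germs. -/
theorem localIso_of_regular_iff (hdet : IsUnit M.det)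
    (h : ∀ v, (∀ k, RegularAt z (v k)) ↔ ∀ k, RegularAt z ((M *ᵥ v) k)) : LocalIso z M := by
  have hsingle : ∀ j i : ι, RegularAt z ((Pi.single j 1 : ι → RatFunc ℂ) i) := by
    intro j i
    rw [Pi.single_apply]; split_ifs
    exacts [regularAt_one, regularAt_zero]
  have h1 : MatRegular z M := fun i j => by
    simpa using (h (Pi.single j 1)).1 (hsingle j) i
  have h2 : MatRegular z M⁻¹ := fun i j => by
    have := (h (M⁻¹ *ᵥ Pi.single j 1)).2 (by
      rw [mulVec_mulVec, mul_nonsing_inv _ hdet, one_mulVec]; exact hsingle j) i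
    simpa using this
  refine ⟨h1, fun h0 => ?_⟩
  have h3 := ratVal_mul h1.det.1 h2.det.1
  rw [← det_mul, mul_nonsing_inv _ hdet, det_one, h0, zero_mul, ratVal_one] at h3
  exact one_ne_zero h3

theorem LocalIso.shift {h : ℂ} (hM : LocalIso (z + h) M) : LocalIso z (M.map (shift h)) := by
  refine ⟨fun i j => regularAt_shift (hM.1 i j), ?_⟩
  have := RingHom.map_det (_root_.shift h) M
  rw [RingHom.mapMatrix_apply] at this
  rw [← this, ratVal_shift hM.1.det.1]
  exact hM.2

end MatrixGerms

/-! ### Elementary modifications -/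

section ElementaryModifications

variable {ι : Type} [DecidableEq ι] {z : ℂ}

/-- The matrix `I + c b aᵗ / (X - z)`. -/
def elemMod (z c : ℂ) (b a : ι → ℂ) : Matrix ι ι (RatFunc ℂ) :=
  1 + (localParam z)⁻¹ • (c • vecMulVec b a).map RatFunc.C

theorem elemMod_apply (z c : ℂ) (b a : ι → ℂ) (i j : ι) : elemMod z c b a i j =
    (1 : Matrix ι ι (RatFunc ℂ)) i j + (localParam z)⁻¹ * RatFunc.C (c * (b i * a j)) := by
  simp [elemMod, vecMulVec_apply]

@[simp] theorem elemMod_zero (z : ℂ) (b a : ι → ℂ) : elemMod z 0 b a = 1 := by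
  ext i j; simp [elemMod_apply]

theorem elemMod_transpose (z c : ℂ) (b a : ι → ℂ) : (elemMod z c b a)ᵀ = elemMod z c a b := by
  ext i j
  rw [transpose_apply, elemMod_apply, elemMod_apply, mul_comm (b j)]
  congr 1
  simp [Matrix.one_apply, eq_comm]

theorem shift_elemMod (h z c : ℂ) (b a : ι → ℂ) :
    (elemMod (z + h) c b a).map (shift h) = elemMod z c b a := by
  ext i j
  rw [map_apply, elemMod_apply, elemMod_apply, map_add, map_mul, map_inv₀, shift_localParam,
    shift_C]
  congr 1
  simp [Matrix.one_apply, apply_ite (shift h)]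

variable [Fintype ι]

theorem elemMod_mul (z c d : ℂ) {b a : ι → ℂ} (h : a ⬝ᵥ b = 0) :
    elemMod z c b a * elemMod z d b a = elemMod z (c + d) b a := by
  have h0 : (c • vecMulVec b a).map (RatFunc.C (K := ℂ)) * (d • vecMulVec b a).map RatFunc.C
      = 0 := by
    rw [← Matrix.map_mul, smul_mul_smul_comm, vecMulVec_mul_vecMulVec, h]
    ext i j; simp
  simp only [elemMod, mul_add, add_mul, one_mul, mul_one, smul_mul_assoc, mul_smul_comm, h0,
    smul_zero, add_zero]
  ext i j
  simp [add_mul]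
  ring

theorem det_elemMod (z c : ℂ) {b a : ι → ℂ} (h : a ⬝ᵥ b = 0) : (elemMod z c b a).det = 1 := by
  have : elemMod z c b a = 1 + replicateCol Unit ((localParam z)⁻¹ • fun i => RatFunc.C (c * b i)) *
      replicateRow Unit (RatFunc.C ∘ a) := by
    ext i j
    simp only [elemMod_apply, Matrix.add_apply, mul_apply, Finset.univ_unique,
      Finset.sum_singleton, replicateCol_apply, replicateRow_apply, Pi.smul_apply, smul_eq_mul,
      Function.comp, map_mul]
    ring
  rw [this, det_one_add_replicateCol_mul_replicateRow, dotProduct_smul]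
  have h1 : (RatFunc.C ∘ a) ⬝ᵥ (fun i => RatFunc.C (c * b i)) = RatFunc.C (c * (a ⬝ᵥ b)) := by
    simp only [dotProduct, map_mul, map_sum, Finset.mul_sum, Function.comp]
    exact Finset.sum_congr rfl fun i _ => by ring
  rw [h1, h]; simp

theorem elemMod_inv (z c : ℂ) {b a : ι → ℂ} (h : a ⬝ᵥ b = 0) :
    (elemMod z c b a)⁻¹ = elemMod z (-c) b a :=
  inv_eq_right_inv (by rw [elemMod_mul z _ _ h]; simp)

theorem localIso_elemMod {x : ℂ} (hz : z ≠ x) (c : ℂ) {b a : ι → ℂ} (h : a ⬝ᵥ b = 0) :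
    LocalIso z (elemMod x c b a) := by
  refine ⟨fun i j => ?_, by rw [det_elemMod x c h]; simp⟩
  rw [elemMod_apply]
  exact (MatRegular.one z i j).add ((regularAt_inv_localParam hz).mul (regularAt_C _))

theorem elemMod_mulVec (z c : ℂ) (b a : ι → ℂ) (v : ι → RatFunc ℂ) (i : ι) :
    (elemMod z c b a *ᵥ v) i =
      v i + (localParam z)⁻¹ * (RatFunc.C (c * b i) * ((RatFunc.C ∘ a) ⬝ᵥ v)) := by
  rw [elemMod, add_mulVec, one_mulVec, smul_mulVec, Pi.add_apply, Pi.smul_apply, smul_eq_mul]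
  congr 2
  simp only [mulVec, dotProduct, Finset.mul_sum]
  refine Finset.sum_congr rfl fun j _ => ?_
  simp [vecMulVec_apply]; ring

theorem mul_elemMod_apply (M : Matrix ι ι (RatFunc ℂ)) (z c : ℂ) (b a : ι → ℂ) (i j : ι) :
    (M * elemMod z c b a) i j =
      M i j + (localParam z)⁻¹ * (RatFunc.C (c * a j) * (M *ᵥ (RatFunc.C ∘ b)) i) := by
  rw [elemMod, mul_add, mul_one, mul_smul_comm, Matrix.add_apply, Matrix.smul_apply,
    smul_eq_mul, mul_apply]
  simp only [mulVec, dotProduct, Finset.mul_sum]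
  congr 1
  refine Finset.sum_congr rfl fun k _ => ?_
  simp only [map_apply, Matrix.smul_apply, vecMulVec_apply, smul_eq_mul, map_mul, Function.comp]
  ring

theorem degLE_elemMod_mulVec (z c : ℂ) (b a : ι → ℂ) {d : ℤ} {v : ι → RatFunc ℂ}
    (hv : ∀ k, DegLE d (v k)) (i : ι) : DegLE d ((elemMod z c b a *ᵥ v) i) := by
  rw [elemMod_mulVec]
  refine (hv i).add ?_
  have h1 : DegLE d ((RatFunc.C ∘ a) ⬝ᵥ v) :=
    degLE_sum _ _ fun k _ => by simpa using (degLE_C (a k)).mul (hv k)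
  exact ((degLE_inv_localParam z).mul ((degLE_C _).mul h1)).mono (by omega)

end ElementaryModifications

/-! ### The triples of an elementary modification -/

theorem ratVal_inv_localParam_mul {u : ℂ} {f : RatFunc ℂ} (hf : RegularAt u f)
    (h0 : ratVal u f = 0) :
    ratVal u ((localParam u)⁻¹ * f) = ratDeriv u f := by
  rw [← ratDeriv_localParam_mul (hf.div_localParam h0),
    mul_inv_cancel_left₀ (localParam_ne_zero u)]

section Covector

variable {ι : Type}

/-- The vector `w' + w'' (X - u)`. -/
def Triple.covector (τ : Triple ι) (u : ℂ) : ι → RatFunc ℂ :=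
  fun i => RatFunc.C (τ.w' i) + RatFunc.C (τ.w'' i) * localParam u

theorem Triple.regularAt_covector (τ : Triple ι) (u : ℂ) (i : ι) :
    RegularAt u (τ.covector u i) :=
  (regularAt_C _).add ((regularAt_C _).mul (regularAt_localParam u u))

theorem Triple.ratVal_covector (τ : Triple ι) (u : ℂ) :
    (fun i => ratVal u (τ.covector u i)) = τ.w' := by
  ext i
  rw [Triple.covector, ratVal_add (regularAt_C _) ((regularAt_C _).mul (regularAt_localParam u u)),
    ratVal_mul (regularAt_C _) (regularAt_localParam u u)]
  simp

theorem Triple.ratDeriv_covector (τ : Triple ι) (u : ℂ) :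
    (fun i => ratDeriv u (τ.covector u i)) = τ.w'' := by
  ext i
  rw [Triple.covector,
    ratDeriv_add (regularAt_C _) ((regularAt_C _).mul (regularAt_localParam u u)),
    ratDeriv_mul (regularAt_C _) (regularAt_localParam u u)]
  simp

end Covector

section Triples

variable {ι : Type} [Fintype ι] {u ε r s : ℂ} {S : Matrix ι ι (RatFunc ℂ)} {b a : ι → ℂ}
  {τ : Triple ι}

/-- Let the germs of sections at `u` of a bundle be `S` applied to regular vectors. The triple `τ`
describes the modification of this bundle whose germs at `u` are `S (I + ε b aᵗ / (X - u))` applied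
to regular vectors: `τ.w` and `τ.w'` are multiples, with factors `r` and `s`, of `S(u) b` and of
`S(u)⁻ᵗ a`, and `⟨w' + w'' (z - u), S(z) b⟩ = -s ε (z - u) + O((z - u)²)`. -/
structure IsModTriple (S : Matrix ι ι (RatFunc ℂ)) (u : ℂ) (b a : ι → ℂ) (ε r s : ℂ)
    (τ : Triple ι) : Prop where
  r_ne : r ≠ 0
  s_ne : s ≠ 0
  w_eq : τ.w = r • (matVal u S *ᵥ b)
  w'_eq : (matVal u S)ᵀ *ᵥ τ.w' = s • a
  slope : τ.w'' ⬝ᵥ (matVal u S *ᵥ b) + τ.w' ⬝ᵥ (matDeriv u S *ᵥ b) = -(s * ε)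

theorem IsModTriple.shift {h : ℂ} (hS : MatRegular (u + h) S)
    (H : IsModTriple (S.map (shift h)) u b a ε r s τ) : IsModTriple S (u + h) b a ε r s τ := by
  obtain ⟨h1, h2, h3, h4, h5⟩ := H
  rw [matVal_shift hS] at h3 h4 h5
  rw [matDeriv_shift hS] at h5
  exact ⟨h1, h2, h3, h4, h5⟩

theorem IsModTriple.pairing_eq (H : IsModTriple S u b a ε r s τ) :
    τ.pairing = -(r * (s * ε + τ.w' ⬝ᵥ (matDeriv u S *ᵥ b))) := by
  rw [Triple.pairing, H.w_eq, smul_dotProduct, dotProduct_comm, smul_eq_mul]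
  linear_combination r * H.slope

theorem IsModTriple.w_dotProduct_w' (hab : a ⬝ᵥ b = 0) (H : IsModTriple S u b a ε r s τ) :
    τ.w ⬝ᵥ τ.w' = 0 := by
  rw [H.w_eq, smul_dotProduct, dotProduct_comm, dotProduct_mulVec, ← mulVec_transpose, H.w'_eq,
    smul_dotProduct, hab]; simp

theorem regularAt_C_dotProduct (b : ι → ℂ) {m : ι → RatFunc ℂ} (hm : ∀ i, RegularAt u (m i)) :
    RegularAt u ((RatFunc.C ∘ b) ⬝ᵥ m) :=
  regularAt_sum _ _ fun i _ => (regularAt_C _).mul (hm i)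

theorem ratVal_C_dotProduct (b : ι → ℂ) {m : ι → RatFunc ℂ} (hm : ∀ i, RegularAt u (m i)) :
    ratVal u ((RatFunc.C ∘ b) ⬝ᵥ m) = b ⬝ᵥ fun i => ratVal u (m i) := by
  simp only [dotProduct, Function.comp]
  rw [ratVal_sum _ _ fun i _ => (regularAt_C _).mul (hm i)]
  exact Finset.sum_congr rfl fun i _ => by rw [ratVal_mul (regularAt_C _) (hm i), ratVal_C]

theorem ratDeriv_C_dotProduct (b : ι → ℂ) {m : ι → RatFunc ℂ} (hm : ∀ i, RegularAt u (m i)) :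
    ratDeriv u ((RatFunc.C ∘ b) ⬝ᵥ m) = b ⬝ᵥ fun i => ratDeriv u (m i) := by
  simp only [dotProduct, Function.comp]
  rw [ratDeriv_sum _ _ fun i _ => (regularAt_C _).mul (hm i)]
  exact Finset.sum_congr rfl fun i _ => by rw [ratDeriv_mul (regularAt_C _) (hm i)]; simp

theorem ratVal_mulVec_C (hS : MatRegular u S) (b : ι → ℂ) (i : ι) :
    ratVal u ((S *ᵥ (RatFunc.C ∘ b)) i) = (matVal u S *ᵥ b) i := by
  rw [ratVal_mulVec (v := RatFunc.C ∘ b) hS fun _ => regularAt_C _]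
  simp

theorem ratDeriv_mulVec_C (hS : MatRegular u S) (b : ι → ℂ) (i : ι) :
    ratDeriv u ((S *ᵥ (RatFunc.C ∘ b)) i) = (matDeriv u S *ᵥ b) i := by
  rw [ratDeriv_mulVec (v := RatFunc.C ∘ b) hS fun _ => regularAt_C _]
  simp [mulVec, dotProduct]

variable [DecidableEq ι]

/-- Change of the frame `S V` to the frame `S`. The last three hypotheses say that `V` carries the
pair `b, a` to the pair `b', a'` up to terms that do not influence the modification. -/
theorem IsModTriple.of_mul {V : Matrix ι ι (RatFunc ℂ)} {b' a' : ι → ℂ} (hS : MatRegular u S)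
    (hV : LocalIso u V) (hb : matVal u V *ᵥ b = b') (ha : (matVal u V)ᵀ *ᵥ a' = a)
    (hd : a' ⬝ᵥ (matDeriv u V *ᵥ b) = 0) (H : IsModTriple (S * V) u b a ε r s τ) :
    IsModTriple S u b' a' ε r s τ := by
  obtain ⟨h1, h2, h3, h4, h5⟩ := H
  rw [matVal_mul hS hV.1] at h3 h4 h5
  rw [matDeriv_mul hS hV.1] at h5
  rw [← mulVec_mulVec, hb] at h3 h5
  have h6 : (matVal u S)ᵀ *ᵥ τ.w' = s • a' := by
    have e : (matVal u V⁻¹)ᵀ * (matVal u V)ᵀ = 1 := by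
      rw [← transpose_mul, hV.matVal_mul_inv, transpose_one]
    rw [transpose_mul, ← mulVec_mulVec, ← ha, ← mulVec_smul] at h4
    have := congrArg ((matVal u V⁻¹)ᵀ *ᵥ ·) h4
    simpa only [mulVec_mulVec, e, one_mulVec, ← mul_assoc, one_mul] using this
  refine ⟨h1, h2, h3, h6, ?_⟩
  have h7 : τ.w' ⬝ᵥ (matVal u S *ᵥ (matDeriv u V *ᵥ b)) = 0 := by
    rw [dotProduct_mulVec, ← mulVec_transpose, h6, smul_dotProduct, hd, smul_zero]
  rw [add_mulVec, ← mulVec_mulVec, hb, dotProduct_add, ← mulVec_mulVec, h7, add_zero] at h5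
  exact h5

/-- The transport of triples is the change of the frame `S` to the frame `G S`. -/
theorem IsModTriple.transport {G : Matrix ι ι (RatFunc ℂ)} (hS : MatRegular u S)
    (hG : LocalIso u G) (H : IsModTriple S u b a ε r s τ) :
    IsModTriple (G * S) u b a ε r s (τ.transport G u) := by
  obtain ⟨h1, h2, h3, h4, h5⟩ := H
  have e1 : (matVal u G)ᵀ * (matVal u G⁻¹)ᵀ = 1 := by
    rw [← transpose_mul, hG.matVal_inv_mul, transpose_one]
  -- the derivative of `G⁻¹ G = 1`
  have e2 : matDeriv u G⁻¹ * matVal u G + matVal u G⁻¹ * matDeriv u G = 0 := by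
    rw [← matDeriv_mul hG.inv.1 hG.1, nonsing_inv_mul _ hG.isUnit_det, matDeriv_one]
  refine ⟨h1, h2, ?_, ?_, ?_⟩
  · simp only [Triple.transport]
    rw [h3, mulVec_smul, matVal_mul hG.1 hS, mulVec_mulVec]
  · simp only [Triple.transport]
    rw [matVal_mul hG.1 hS, transpose_mul, mulVec_mulVec, mul_assoc, e1, mul_one, h4]
  · simp only [Triple.transport]
    rw [matVal_mul hG.1 hS, matDeriv_mul hG.1 hS, ← h5]
    simp only [mulVec_transpose, add_dotProduct, add_mulVec, dotProduct_add, ← dotProduct_mulVec,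
      mulVec_mulVec]
    simp only [← mul_assoc, hG.matVal_inv_mul, one_mul]
    have e3 : matDeriv u G⁻¹ * matVal u G = -(matVal u G⁻¹ * matDeriv u G) :=
      eq_neg_of_add_eq_zero_left e2
    rw [e3, neg_mul, neg_mulVec, dotProduct_neg]
    ring

theorem matVal_mulVec_ne_zero (hS : LocalIso u S) (hb : b ≠ 0) : matVal u S *ᵥ b ≠ 0 := by
  intro h
  apply hb
  have := congrArg (matVal u S⁻¹ *ᵥ ·) h
  simpa only [mulVec_mulVec, hS.matVal_inv_mul, one_mulVec, mulVec_zero] using this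

/-- Only `⟨w'', S(u) b⟩` is prescribed, and `S(u) b ≠ 0`. -/
theorem exists_isModTriple (hS : LocalIso u S) (hb : b ≠ 0) (ε : ℂ) :
    ∃ τ, IsModTriple S u b a ε 1 1 τ := by
  set w := matVal u S *ᵥ b with hw
  have hw0 : w ≠ 0 := matVal_mulVec_ne_zero hS hb
  obtain ⟨i, hi⟩ := Function.ne_iff.1 hw0
  set w' := (matVal u S⁻¹)ᵀ *ᵥ a with hw'
  refine ⟨⟨w, w', Pi.single i ((-ε - w' ⬝ᵥ (matDeriv u S *ᵥ b)) / w i)⟩, one_ne_zero,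
    one_ne_zero, by simp [hw], ?_, ?_⟩
  · simp only [hw']
    rw [mulVec_mulVec, ← transpose_mul, hS.matVal_inv_mul, transpose_one, one_mulVec, one_smul]
  · simp only
    rw [← hw, single_dotProduct, div_mul_cancel₀ _ hi]
    ring

/-- For a regular vector `m`, the vector `(I + ε a bᵗ / (X - u)) m` vanishes at `u` if and only if
`⟨b, m⟩` vanishes there and `m(u) = -ε ⟨b, m⟩'(u) a`. -/
theorem vanishesAt_elemMod_mulVec_iff (hε : ε ≠ 0) (ha : a ≠ 0) {m : ι → RatFunc ℂ}
    (hm : ∀ i, RegularAt u (m i)) :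
    (∀ k, VanishesAt u ((elemMod u ε a b *ᵥ m) k)) ↔
      (b ⬝ᵥ fun i => ratVal u (m i)) = 0 ∧
        (fun i => ratVal u (m i)) = (-ε * (b ⬝ᵥ fun i => ratDeriv u (m i))) • a := by
  set μ := (RatFunc.C ∘ b) ⬝ᵥ m with hμ
  have hμr : RegularAt u μ := regularAt_C_dotProduct b hm
  have e : ∀ k, (elemMod u ε a b *ᵥ m) k =
      m k + RatFunc.C (ε * a k) * ((localParam u)⁻¹ * μ) := fun k => by
    rw [elemMod_mulVec]; ring
  rw [← ratVal_C_dotProduct b hm, ← ratDeriv_C_dotProduct b hm, ← hμ]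
  have main : ratVal u μ = 0 → ∀ k, RegularAt u ((elemMod u ε a b *ᵥ m) k) ∧
      ratVal u ((elemMod u ε a b *ᵥ m) k) = ratVal u (m k) + ε * a k * ratDeriv u μ := by
    intro h0 k
    have h1 := hμr.div_localParam h0
    rw [e]
    refine ⟨(hm k).add ((regularAt_C _).mul h1), ?_⟩
    rw [ratVal_add (hm k) ((regularAt_C _).mul h1), ratVal_mul (regularAt_C _) h1, ratVal_C,
      ratVal_inv_localParam_mul hμr h0]
  constructor
  · intro h
    obtain ⟨k, hk⟩ := Function.ne_iff.1 ha
    -- a component with `a k ≠ 0` shows that `⟨b, m⟩ / (X - u)` is regular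
    have h1 : RegularAt u ((localParam u)⁻¹ * μ) := by
      have h2 := (regularAt_C (ε * a k)⁻¹).mul ((h k).1.sub (hm k))
      rw [e, add_sub_cancel_left, ← mul_assoc, ← map_mul,
        inv_mul_cancel₀ (mul_ne_zero hε hk), map_one, one_mul] at h2
      exact h2
    have h0 : ratVal u μ = 0 := by
      have := ratVal_mul (regularAt_localParam u u) h1
      rw [mul_inv_cancel_left₀ (localParam_ne_zero u)] at this
      simpa using this
    refine ⟨h0, funext fun k => ?_⟩
    have := (h k).2
    rw [(main h0 k).2] at this
    rw [Pi.smul_apply, smul_eq_mul]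
    linear_combination this
  · rintro ⟨h0, h1⟩ k
    refine ⟨(main h0 k).1, ?_⟩
    rw [(main h0 k).2, congrFun h1 k, Pi.smul_apply, smul_eq_mul]
    ring

section Singularity

variable {B S₂ : Matrix ι ι (RatFunc ℂ)}

/-- Only the factor `I + ε b aᵗ / (X - u)` contributes to the polar part. -/
theorem regular_localParam_smul (hS : LocalIso u S) (hS₂ : LocalIso u S₂)
    (hB : B = S * elemMod u ε b a * S₂) : MatRegular u (localParam u • B) ∧
      matRes u B = matVal u S * (ε • vecMulVec b a) * matVal u S₂ := by
  have h1 : localParam u • elemMod u ε b a = (localParam u • (1 : Matrix ι ι (RatFunc ℂ))) +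
      (ε • vecMulVec b a).map RatFunc.C := by
    rw [elemMod, smul_add, smul_smul, mul_inv_cancel₀ (localParam_ne_zero u), one_smul]
  have h2 : localParam u • B = S * (localParam u • elemMod u ε b a) * S₂ := by
    rw [hB, mul_smul_comm, smul_mul_assoc]
  have h3 : MatRegular u (localParam u • (1 : Matrix ι ι (RatFunc ℂ))) := fun i j =>
    (regularAt_localParam u u).mul (MatRegular.one u i j)
  have h4 : matVal u (localParam u • (1 : Matrix ι ι (RatFunc ℂ))) = 0 := by
    ext i j
    simp only [matVal, map_apply, Matrix.smul_apply, smul_eq_mul]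
    rw [ratVal_mul (regularAt_localParam u u) (MatRegular.one u i j)]
    simp
  have h5 : MatRegular u (localParam u • elemMod u ε b a) := by
    rw [h1]; exact h3.add (MatRegular.map_C u _)
  rw [h2]
  refine ⟨(hS.1.mul h5).mul hS₂.1, ?_⟩
  have h6 : matRes u B = matVal u (localParam u • B) := rfl
  rw [h6, h2, matVal_mul (hS.1.mul h5) hS₂.1, matVal_mul hS.1 h5, h1,
    matVal_add h3 (MatRegular.map_C u _), h4, zero_add, matVal_map_C]

theorem range_matRes (hS : LocalIso u S) (hS₂ : LocalIso u S₂) (hε : ε ≠ 0) (ha : a ≠ 0)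
    (hB : B = S * elemMod u ε b a * S₂) :
    LinearMap.range (matRes u B).mulVecLin = Submodule.span ℂ {matVal u S *ᵥ b} := by
  have key : ∀ x, (matRes u B).mulVecLin x =
      (ε * (a ⬝ᵥ (matVal u S₂ *ᵥ x))) • (matVal u S *ᵥ b) := fun x => by
    rw [(regular_localParam_smul hS hS₂ hB).2, mulVecLin_apply, ← mulVec_mulVec, ← mulVec_mulVec,
      smul_mulVec, vecMulVec_mulVec, mulVec_smul, op_smul_eq_smul, mulVec_smul, smul_smul]
  apply le_antisymm
  · rintro _ ⟨x, rfl⟩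
    rw [key]
    exact Submodule.smul_mem _ _ (Submodule.mem_span_singleton_self _)
  · rw [Submodule.span_singleton_le_iff_mem]
    obtain ⟨k, hk⟩ := Function.ne_iff.1 ha
    refine ⟨matVal u S₂⁻¹ *ᵥ Pi.single k (ε * a k)⁻¹, ?_⟩
    rw [key, mulVec_mulVec, hS₂.matVal_mul_inv, one_mulVec, dotProduct_single]
    have : ε * (a k * (ε * a k)⁻¹) = 1 := by
      have hk' : a k ≠ 0 := hk
      field_simp
    rw [this, one_smul]

theorem hasSingularity_of_eq (hS : LocalIso u S) (hS₂ : LocalIso u S₂) (hε : ε ≠ 0) (ha : a ≠ 0)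
    (hb : b ≠ 0) (hab : a ⬝ᵥ b = 0) (hB : B = S * elemMod u ε b a * S₂) : HasSingularity B u := by
  have hdet : B.det = S.det * S₂.det := by
    rw [hB, det_mul, det_mul, det_elemMod u ε hab, mul_one]
  refine ⟨(regular_localParam_smul hS hS₂ hB).1, ?_, ?_, ?_⟩
  · rw [Matrix.rank, range_matRes hS hS₂ hε ha hB,
      finrank_span_singleton (matVal_mulVec_ne_zero hS hb)]
  · rw [hdet]; exact hS.1.det.1.mul hS₂.1.det.1
  · rw [hdet, ratVal_mul hS.1.det.1 hS₂.1.det.1]; exact mul_ne_zero hS.2 hS₂.2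

/-- If the matrix that is singular at `u` is an elementary modification in the frame `S`, then the
triples attached to it are those of this modification. -/
theorem isTriple_iff {A : Matrix ι ι (RatFunc ℂ)} {d : Dir} (hS : LocalIso u S)
    (hS₂ : LocalIso u S₂) (hε : ε * ε = 1) (ha : a ≠ 0) (hb : b ≠ 0) (hab : a ⬝ᵥ b = 0)
    (hB : d.singularMatrix A = S * elemMod u ε b a * S₂) :
    IsTriple A u d τ ↔ ∃ r s, IsModTriple S u b a ε r s τ := by
  have hε0 : ε ≠ 0 := by rintro rfl; simp at hε
  have hSb := matVal_mulVec_ne_zero hS hb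
  set m := Sᵀ *ᵥ τ.covector u with hm
  have hmr : ∀ i, RegularAt u (m i) := hS.1.transpose.mulVec (τ.regularAt_covector u)
  have hmv : (fun i => ratVal u (m i)) = (matVal u S)ᵀ *ᵥ τ.w' := by
    ext i
    rw [hm, ratVal_mulVec hS.1.transpose (τ.regularAt_covector u), τ.ratVal_covector]
    rfl
  have hmd : (b ⬝ᵥ fun i => ratDeriv u (m i)) =
      τ.w'' ⬝ᵥ (matVal u S *ᵥ b) + τ.w' ⬝ᵥ (matDeriv u S *ᵥ b) := by
    have : (fun i => ratDeriv u (m i)) =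
        (matDeriv u S)ᵀ *ᵥ τ.w' + (matVal u S)ᵀ *ᵥ τ.w'' := by
      ext i
      rw [hm, ratDeriv_mulVec hS.1.transpose (τ.regularAt_covector u), τ.ratVal_covector,
        τ.ratDeriv_covector]
      rfl
    rw [this, dotProduct_add, dotProduct_comm b, dotProduct_comm b, mulVec_transpose,
      mulVec_transpose, ← dotProduct_mulVec, ← dotProduct_mulVec, add_comm]
  have hvan : (∀ k, VanishesAt u (((d.singularMatrix A)ᵀ *ᵥ
      fun i => RatFunc.C (τ.w' i) + RatFunc.C (τ.w'' i) * localParam u) k)) ↔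
      ∀ k, VanishesAt u ((elemMod u ε a b *ᵥ m) k) := by
    rw [← hS₂.transpose.vanishes_mulVec_iff (elemMod u ε a b *ᵥ m), hB, transpose_mul,
      transpose_mul, elemMod_transpose,
      hm, mulVec_mulVec, mulVec_mulVec, mul_assoc]
    rfl
  rw [IsTriple, hvan, vanishesAt_elemMod_mulVec_iff hε0 ha hmr, hmv, hmd,
    range_matRes hS hS₂ hε0 ha hB]
  constructor
  · rintro ⟨hw, hspan, -, hw', -, h1⟩
    obtain ⟨r, hr⟩ := Submodule.span_singleton_eq_span_singleton.1 hspan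
    refine ⟨r, _, r.ne_zero, ?_, hr.symm, h1, ?_⟩
    · intro h0
      rw [h0, zero_smul] at h1
      apply hw'
      have := congrArg ((matVal u S⁻¹)ᵀ *ᵥ ·) h1
      simpa only [mulVec_mulVec, ← transpose_mul, hS.matVal_mul_inv, transpose_one, one_mulVec,
        mulVec_zero] using this
    · linear_combination -(τ.w'' ⬝ᵥ (matVal u S *ᵥ b) + τ.w' ⬝ᵥ (matDeriv u S *ᵥ b)) * hε
  · rintro ⟨r, s, H⟩
    have hw' : (matVal u S)ᵀ *ᵥ τ.w' ≠ 0 := by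
      rw [H.w'_eq]; exact smul_ne_zero H.s_ne ha
    refine ⟨?_, ?_, H.w_dotProduct_w' hab, fun h => hw' (by rw [h, mulVec_zero]), ?_, ?_⟩
    · rw [H.w_eq]; exact smul_ne_zero H.r_ne hSb
    · exact Submodule.span_singleton_eq_span_singleton.2 ⟨Units.mk0 r H.r_ne, H.w_eq.symm⟩
    · rw [H.w'_eq, dotProduct_smul, dotProduct_comm, hab, smul_zero]
    · rw [H.w'_eq, H.slope]
      congr 1
      linear_combination -s * hε

end Singularity

/-- The gauge matrix of a triple turns the frame `S` into a frame of the modified bundle. -/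
theorem IsModTriple.localIso_gauge (hS : LocalIso u S) (hε : ε * ε = 1) (hab : a ⬝ᵥ b = 0)
    (H : IsModTriple S u b a ε r s τ) (hP : τ.pairing ≠ 0) :
    LocalIso u (τ.gauge u * S * elemMod u ε b a) := by
  have hgauge : τ.gauge u = elemMod u τ.pairing⁻¹ τ.w τ.w' := rfl
  refine ⟨fun i j => ?_, ?_⟩
  swap
  · rw [det_mul, det_mul, hgauge, det_elemMod u _ hab,
      det_elemMod u _ (by rw [dotProduct_comm]; exact H.w_dotProduct_w' hab), one_mul, mul_one]
    exact hS.2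
  have ht := localParam_ne_zero u
  have hr := H.r_ne
  -- `S b = w / r + (X - u) g`
  have hSb : ∀ i, RegularAt u ((S *ᵥ (RatFunc.C ∘ b)) i) := hS.1.mulVec fun _ => regularAt_C _
  have hSbv : ∀ i, ratVal u ((S *ᵥ (RatFunc.C ∘ b)) i) = r⁻¹ * τ.w i := fun i => by
    rw [ratVal_mulVec_C hS.1, H.w_eq]
    simp [hr]
  choose g hg hgeq using fun i => (hSb i).exists_eq_add
  -- `w'ᵗ S = s aᵗ + (X - u) hᵗ`
  have hSw : ∀ j, RegularAt u ((Sᵀ *ᵥ (RatFunc.C ∘ τ.w')) j) :=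
    hS.1.transpose.mulVec fun _ => regularAt_C _
  have hSwv : ∀ j, ratVal u ((Sᵀ *ᵥ (RatFunc.C ∘ τ.w')) j) = s * a j := fun j => by
    rw [ratVal_mulVec_C hS.1.transpose, matVal_transpose]
    simpa using congrFun H.w'_eq j
  choose h hh hheq using fun j => (hSw j).exists_eq_add
  -- `w'ᵗ S b = (X - u) (-s ε - ⟨w, w''⟩ / r + (X - u) l)`
  set μ := (RatFunc.C ∘ τ.w') ⬝ᵥ (S *ᵥ (RatFunc.C ∘ b)) with hμ
  have hμr : RegularAt u μ := regularAt_C_dotProduct _ hSb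
  have hμ0 : ratVal u μ = 0 := by
    rw [hμ, ratVal_C_dotProduct _ hSb]
    simp_rw [hSbv]
    have := H.w_dotProduct_w' hab
    rw [dotProduct_comm] at this
    have h2 : (fun i => r⁻¹ * τ.w i) = r⁻¹ • τ.w := rfl
    rw [h2, dotProduct_smul, this, smul_zero]
  have hμd : ratDeriv u μ = -(s * ε) - τ.pairing / r := by
    rw [hμ, ratDeriv_C_dotProduct _ hSb]
    have h2 : (fun i => ratDeriv u ((S *ᵥ (RatFunc.C ∘ b)) i)) = matDeriv u S *ᵥ b := by
      ext i
      exact ratDeriv_mulVec_C hS.1 b i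
    rw [h2, H.pairing_eq]
    field_simp
    ring
  obtain ⟨l, hl, hleq⟩ := (hμr.div_localParam hμ0).exists_eq_add
  rw [ratVal_inv_localParam_mul hμr hμ0, hμd] at hleq
  have hμeq : μ = localParam u *
      (RatFunc.C (-(s * ε) - τ.pairing / r) + localParam u * l) := by
    rw [← hleq, mul_inv_cancel_left₀ ht]
  -- the product, with the poles of second and first order written out
  have hexp : (τ.gauge u * S * elemMod u ε b a) i j = S i j +
      (localParam u)⁻¹ * (RatFunc.C (τ.pairing⁻¹ * τ.w i) * (Sᵀ *ᵥ (RatFunc.C ∘ τ.w')) j) +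
      ((localParam u)⁻¹ * (RatFunc.C (ε * a j) * (S *ᵥ (RatFunc.C ∘ b)) i) +
      (localParam u)⁻¹ * (localParam u)⁻¹ *
        (RatFunc.C (τ.pairing⁻¹ * τ.w i) * RatFunc.C (ε * a j) * μ)) := by
    have h2 : ∀ v : ι → RatFunc ℂ, (τ.gauge u *ᵥ v) i =
        v i + (localParam u)⁻¹ * (RatFunc.C (τ.pairing⁻¹ * τ.w i) *
          ((RatFunc.C ∘ τ.w') ⬝ᵥ v)) := fun v => by rw [hgauge, elemMod_mulVec]
    have h3 : (τ.gauge u * S) i j = (τ.gauge u *ᵥ fun k => S k j) i := rfl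
    have h4 : (RatFunc.C ∘ τ.w') ⬝ᵥ (fun k => S k j) = (Sᵀ *ᵥ (RatFunc.C ∘ τ.w')) j := by
      rw [dotProduct_comm]; rfl
    rw [mul_elemMod_apply, ← mulVec_mulVec, h2, h3, h2, h4, ← hμ]
    ring
  have hfin : (τ.gauge u * S * elemMod u ε b a) i j = S i j +
      RatFunc.C (τ.pairing⁻¹ * τ.w i) * h j + RatFunc.C (ε * a j) * g i +
      RatFunc.C (τ.pairing⁻¹ * τ.w i) * RatFunc.C (ε * a j) * l := by
    have hPC : (RatFunc.C τ.pairing : RatFunc ℂ) ≠ 0 := by simpa using hP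
    have hrC : (RatFunc.C r : RatFunc ℂ) ≠ 0 := by simpa using hr
    have hεC : (RatFunc.C ε : RatFunc ℂ) * RatFunc.C ε = 1 := by rw [← map_mul, hε, map_one]
    rw [hexp, hgeq i, hheq j, hSbv, hSwv, hμeq]
    simp only [map_mul, map_inv₀, map_sub, map_neg, map_div₀]
    field_simp
    linear_combination (-RatFunc.C (τ.w i) * RatFunc.C (a j) * RatFunc.C s * RatFunc.C r) * hεC
  rw [hfin]
  exact (((hS.1 i j).add ((regularAt_C _).mul (hh j))).add ((regularAt_C _).mul (hg i))).add
    (((regularAt_C _).mul (regularAt_C _)).mul hl)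

end Triples

namespace Ensemble

variable {p q N : ℕ} (E : Ensemble p q N)

theorem φ_symm (i : Fin p) (l : Fin (E.n i)) (y : ℂ) :
    E.φ (E.enumφ.symm ⟨i, l⟩) y = E.ω₁ i y * y ^ (l : ℕ) := by
  rw [φ, Equiv.apply_symm_apply]

theorem ψ_symm (j : Fin q) (l : Fin (E.m j)) (y : ℂ) :
    E.ψ (E.enumψ.symm ⟨j, l⟩) y = E.ω₂ j y * y ^ (l : ℕ) := by
  rw [ψ, Equiv.apply_symm_apply]

/-! ### Partition functions as Gram determinants -/

/-- The Gram matrix `∑_{y ∈ Y} ψₖ(y) φₗ(y)`. -/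
def gram (Y : Finset ℂ) : Matrix (Fin N) (Fin N) ℂ :=
  Matrix.of fun k l => ∑ y ∈ Y, E.ψ k y * E.φ l y

/-- The Andréief identity. -/
theorem partialSum_eq (Y : Finset ℂ) : E.partialSum Y = N.factorial * (E.gram Y).det := by
  have h1 : ∀ σ : Equiv.Perm (Fin N),
      ∑ x ∈ Fintype.piFinset (fun _ : Fin N => Y),
        (Matrix.of fun i j => E.φ i (x j)).det * ∏ j, E.ψ (σ j) (x j) =
      Equiv.Perm.sign σ * (E.gram Y).det := by
    intro σ
    have h2 := (Matrix.detRowAlternating (n := Fin N) (R := ℂ)).toMultilinearMap.map_sum_finset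
      (fun j y => fun i => E.ψ (σ j) y * E.φ i y) (fun _ => Y)
    rw [← det_permute σ (E.gram Y)]
    have h3 : (E.gram Y).submatrix σ id =
        fun j => ∑ y ∈ Y, fun i => E.ψ (σ j) y * E.φ i y := by
      ext j i
      simp [gram, Finset.sum_apply]
    rw [h3]
    refine Eq.trans ?_ h2.symm
    refine Finset.sum_congr rfl fun x _ => ?_
    rw [← det_transpose, mul_comm, ← det_mul_column]
    rfl
  rw [partialSum]
  have h4 : ∀ x : Fin N → ℂ, E.F x = ∑ σ : Equiv.Perm (Fin N),
      (Equiv.Perm.sign σ : ℂ) *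
        ((Matrix.of fun i j => E.φ i (x j)).det * ∏ j, E.ψ (σ j) (x j)) := fun x => by
    rw [F, det_apply' (Matrix.of fun i j => E.ψ i (x j)), Finset.mul_sum]
    refine Finset.sum_congr rfl fun σ _ => ?_
    simp only [of_apply]
    ring
  simp_rw [h4]
  rw [Finset.sum_comm]
  simp_rw [← Finset.mul_sum, h1, ← mul_assoc]
  have h5 : ∀ σ : Equiv.Perm (Fin N), (Equiv.Perm.sign σ : ℂ) * (Equiv.Perm.sign σ : ℂ) = 1 := by
    intro σ
    rcases Int.units_eq_one_or (Equiv.Perm.sign σ) with h | h <;> simp [h]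
  simp [h5, Fintype.card_perm]

/-! ### The bundles in local frames -/

/-- The vector `(ω₁(x); 0)`. -/
def upperVec (x : ℂ) : Fin p ⊕ Fin q → ℂ := Sum.elim (fun i => E.ω₁ i x) 0

/-- The vector `(0; ω₂(x))`. -/
def lowerVec (x : ℂ) : Fin p ⊕ Fin q → ℂ := Sum.elim 0 fun j => E.ω₂ j x

theorem upperVec_dotProduct_lowerVec (x y : ℂ) : E.upperVec x ⬝ᵥ E.lowerVec y = 0 := by
  simp [upperVec, lowerVec, dotProduct]

theorem upperVec_ne_zero (hp : 0 < p) {x : ℂ} (hx : x ∈ E.X) : E.upperVec x ≠ 0 := fun h =>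
  E.ω₁_ne_zero ⟨0, hp⟩ x hx (congrFun h (.inl ⟨0, hp⟩))

theorem lowerVec_ne_zero (hq : 0 < q) {x : ℂ} (hx : x ∈ E.X) : E.lowerVec x ≠ 0 := fun h =>
  E.ω₂_ne_zero ⟨0, hq⟩ x hx (congrFun h (.inr ⟨0, hq⟩))

open Classical in
/-- The indicator function of `Y`. -/
def indicator (Y : Finset ℂ) (z : ℂ) : ℂ := if z ∈ Y then 1 else 0

/-- The matrix whose columns are a frame of `L_Y` near `z`. -/
def frame (Y : Finset ℂ) (z : ℂ) : Matrix (Fin p ⊕ Fin q) (Fin p ⊕ Fin q) (RatFunc ℂ) :=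
  elemMod z (indicator Y z) (E.lowerVec z) (E.upperVec z)

theorem frame_inv (Y : Finset ℂ) (z : ℂ) :
    (E.frame Y z)⁻¹ = elemMod z (-indicator Y z) (E.lowerVec z) (E.upperVec z) :=
  elemMod_inv z _ (E.upperVec_dotProduct_lowerVec z z)

theorem det_frame (Y : Finset ℂ) (z : ℂ) : (E.frame Y z).det = 1 :=
  det_elemMod z _ (E.upperVec_dotProduct_lowerVec z z)

theorem frame_mul_inv (Y : Finset ℂ) (z : ℂ) : E.frame Y z * (E.frame Y z)⁻¹ = 1 :=
  mul_nonsing_inv _ (by rw [det_frame]; exact isUnit_one)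

theorem frame_inv_mul (Y : Finset ℂ) (z : ℂ) : (E.frame Y z)⁻¹ * E.frame Y z = 1 :=
  nonsing_inv_mul _ (by rw [det_frame]; exact isUnit_one)

theorem upperVec_dotProduct (x : ℂ) (s : Fin p ⊕ Fin q → RatFunc ℂ) :
    (RatFunc.C ∘ E.upperVec x) ⬝ᵥ s = ∑ i, RatFunc.C (E.ω₁ i x) * s (.inl i) := by
  simp [upperVec, dotProduct]

theorem frame_inv_mulVec_inl (Y : Finset ℂ) (z : ℂ) (s : Fin p ⊕ Fin q → RatFunc ℂ) (i : Fin p) :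
    ((E.frame Y z)⁻¹ *ᵥ s) (.inl i) = s (.inl i) := by
  rw [frame_inv, elemMod_mulVec]; simp [lowerVec]

theorem frame_inv_mulVec_inr (Y : Finset ℂ) (z : ℂ) (s : Fin p ⊕ Fin q → RatFunc ℂ) (j : Fin q) :
    ((E.frame Y z)⁻¹ *ᵥ s) (.inr j) = s (.inr j) - (localParam z)⁻¹ *
      (RatFunc.C (indicator Y z * E.ω₂ j z) * ∑ i, RatFunc.C (E.ω₁ i z) * s (.inl i)) := by
  rw [frame_inv, elemMod_mulVec, upperVec_dotProduct]
  simp only [lowerVec, Sum.elim_inr, neg_mul, map_neg, mul_neg]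
  ring

/-- The sections of `L_Y` near `z` are the regular combinations of the frame. -/
theorem isSectionAt_iff (Y : Finset ℂ) (z : ℂ) (s : Fin p ⊕ Fin q → RatFunc ℂ) :
    E.IsSectionAt Y z s ↔ ∀ k, RegularAt z (((E.frame Y z)⁻¹ *ᵥ s) k) := by
  rw [Sum.forall]
  simp_rw [frame_inv_mulVec_inl, frame_inv_mulVec_inr]
  rw [IsSectionAt]
  refine and_congr_right fun h1 => ?_
  by_cases hz : z ∈ Y
  swap
  · simp [hz, indicator]
  simp only [hz, not_true_eq_false, false_implies, true_implies, true_and, indicator, if_true,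
    one_mul]
  refine forall_congr' fun j => ?_
  have h2 : RegularAt z (∑ i, RatFunc.C (E.ω₁ i z) * s (.inl i)) :=
    regularAt_sum _ _ fun i _ => (regularAt_C _).mul (h1 i)
  have h3 : ratVal z (∑ i, RatFunc.C (E.ω₁ i z) * s (.inl i)) =
      ∑ i, E.ω₁ i z * ratVal z (s (.inl i)) := by
    rw [ratVal_sum _ _ fun i _ => (regularAt_C _).mul (h1 i)]
    exact Finset.sum_congr rfl fun i _ => by rw [ratVal_mul (regularAt_C _) (h1 i), ratVal_C]
  set σ₁ := ∑ i, RatFunc.C (E.ω₁ i z) * s (.inl i)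
  have h4 : RegularAt z (RatFunc.C (E.ω₂ j z) * σ₁) := (regularAt_C _).mul h2
  have h5 : ratVal z (RatFunc.C (E.ω₂ j z) * σ₁) =
      E.ω₂ j z * ∑ i, E.ω₁ i z * ratVal z (s (.inl i)) := by
    rw [ratVal_mul (regularAt_C _) h2, ratVal_C, h3]
  have ht := localParam_ne_zero z
  rw [← h5, AtMostSimplePole, simpleRes]
  constructor
  · rintro ⟨h6, h7⟩
    have h8 := (h6.sub h4).div_localParam (by rw [ratVal_sub h6 h4, h7, sub_self])
    rwa [mul_sub, inv_mul_cancel_left₀ ht] at h8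
  · intro h6
    have h7 : localParam z * s (.inr j) = localParam z * (s (.inr j) - (localParam z)⁻¹ *
        (RatFunc.C (E.ω₂ j z) * σ₁)) + RatFunc.C (E.ω₂ j z) * σ₁ := by
      rw [mul_sub, mul_inv_cancel_left₀ ht]; ring
    rw [h7]
    refine ⟨((regularAt_localParam z z).mul h6).add h4, ?_⟩
    rw [ratVal_add ((regularAt_localParam z z).mul h6) h4,
      ratVal_mul (regularAt_localParam z z) h6]
    simp

variable {E} {Y : Finset ℂ} {T : Matrix (Fin p ⊕ Fin q) (Fin p ⊕ Fin q) (RatFunc ℂ)}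

theorem IsTrivialization.localIso (hT : E.IsTrivialization Y T) (z : ℂ) :
    LocalIso z (T * E.frame Y z) := by
  refine localIso_of_regular_iff (by rw [det_mul, det_frame, mul_one]; exact hT.1) fun v => ?_
  rw [← mulVec_mulVec, ← hT.2.1 z, isSectionAt_iff, mulVec_mulVec, frame_inv_mul, one_mulVec]

theorem isSectionAt_iff_of_localIso {z : ℂ} (h : LocalIso z (T * E.frame Y z))
    (s : Fin p ⊕ Fin q → RatFunc ℂ) :
    E.IsSectionAt Y z s ↔ ∀ k, RegularAt z ((T *ᵥ s) k) := by
  rw [isSectionAt_iff, ← h.regular_mulVec_iff, mulVec_mulVec, mul_assoc, frame_mul_inv, mul_one]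

variable (E)

/-! ### Sections with prescribed polar part -/

/-- The function `∑ₖ vₖ φₖ` on the phase space. -/
def comb (v : Fin N → ℂ) (y : ℂ) : ℂ := ∑ k, E.φ k y * v k

/-- The rational section whose upper part is made of the polynomials with coefficients `v`, and
whose lower part has the poles in `Y` that a section of `L_Y` is required to have. -/
def coeffSection (Y : Finset ℂ) (v : Fin N → ℂ) : Fin p ⊕ Fin q → RatFunc ℂ :=
  Sum.elim
    (fun i => ∑ l : Fin (E.n i), RatFunc.C (v (E.enumφ.symm ⟨i, l⟩)) * RatFunc.X ^ (l : ℕ))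
    fun j => ∑ y ∈ Y, RatFunc.C (E.ω₂ j y * E.comb v y) * (localParam y)⁻¹

theorem coeffSection_inl (Y : Finset ℂ) (v : Fin N → ℂ) (i : Fin p) :
    E.coeffSection Y v (.inl i) = algebraMap (Polynomial ℂ) (RatFunc ℂ)
      (∑ l : Fin (E.n i), Polynomial.C (v (E.enumφ.symm ⟨i, l⟩)) * Polynomial.X ^ (l : ℕ)) := by
  simp [coeffSection, RatFunc.algebraMap_X, RatFunc.algebraMap_C]

theorem sum_ratVal_coeffSection (Y : Finset ℂ) (v : Fin N → ℂ) (z : ℂ) :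
    ∑ i, E.ω₁ i z * ratVal z (E.coeffSection Y v (.inl i)) = E.comb v z := by
  rw [comb, ← E.enumφ.symm.sum_comp, Fintype.sum_sigma]
  refine Finset.sum_congr rfl fun i _ => ?_
  rw [coeffSection_inl, ratVal_algebraMap, Polynomial.eval_finsetSum, Finset.mul_sum]
  refine Finset.sum_congr rfl fun l _ => ?_
  rw [φ_symm]
  simp
  ring

theorem isSectionAt_coeffSection (Y : Finset ℂ) (v : Fin N → ℂ) (z : ℂ) :
    E.IsSectionAt Y z (E.coeffSection Y v) := by
  refine ⟨fun i => by rw [coeffSection_inl]; exact regularAt_algebraMap _, fun hz j => ?_,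
    fun hz j => ?_⟩
  · refine regularAt_sum _ _ fun y hy => (regularAt_C _).mul (regularAt_inv_localParam ?_)
    rintro rfl; exact hz hy
  · classical
    have h1 : RegularAt z (∑ y ∈ Y.erase z, RatFunc.C (E.ω₂ j y * E.comb v y) *
        (localParam y)⁻¹) :=
      regularAt_sum _ _ fun y hy => (regularAt_C _).mul
        (regularAt_inv_localParam (Finset.ne_of_mem_erase hy).symm)
    have h2 : localParam z * E.coeffSection Y v (.inr j) = RatFunc.C (E.ω₂ j z * E.comb v z) +
        localParam z * ∑ y ∈ Y.erase z, RatFunc.C (E.ω₂ j y * E.comb v y) *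
          (localParam y)⁻¹ := by
      have ht := localParam_ne_zero z
      simp only [coeffSection, Sum.elim_inr]
      rw [← Finset.add_sum_erase Y _ hz]
      field_simp
    rw [AtMostSimplePole, simpleRes, h2, sum_ratVal_coeffSection]
    refine ⟨(regularAt_C _).add ((regularAt_localParam z z).mul h1), ?_⟩
    rw [ratVal_add (regularAt_C _) ((regularAt_localParam z z).mul h1),
      ratVal_mul (regularAt_localParam z z) h1, ratVal_C, ratVal_localParam, sub_self, zero_mul,
      add_zero]

/-- The moment conditions at infinity are a linear system with the Gram matrix. -/
theorem isSectionAtInfty_coeffSection {Y : Finset ℂ} {v : Fin N → ℂ} {x κ : ℂ}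
    (h : ∀ k, (E.gram Y *ᵥ v) k + κ * E.ψ k x = 0) :
    E.IsSectionAtInfty (E.coeffSection Y v +
      (RatFunc.C κ * (localParam x)⁻¹) • (RatFunc.C ∘ E.lowerVec x)) := by
  constructor
  · intro i
    have h1 : (E.coeffSection Y v + (RatFunc.C κ * (localParam x)⁻¹) •
        (RatFunc.C ∘ E.lowerVec x)) (.inl i) = E.coeffSection Y v (.inl i) := by
      simp [lowerVec]
    rw [h1]
    simp only [coeffSection, Sum.elim_inl]
    refine degLE_sum _ _ fun l _ => ?_
    have h2 : DegLE (l : ℤ) (RatFunc.X ^ (l : ℕ)) := by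
      right
      rw [← RatFunc.algebraMap_X, ← map_pow, RatFunc.intDegree_polynomial]
      simp
    exact ((degLE_C _).mul h2).mono (by have := l.2; omega)
  · intro j
    have h1 : (E.coeffSection Y v + (RatFunc.C κ * (localParam x)⁻¹) •
        (RatFunc.C ∘ E.lowerVec x)) (.inr j) =
        ∑ y ∈ Y, RatFunc.C (E.ω₂ j y * E.comb v y) * (localParam y)⁻¹ +
          RatFunc.C (κ * E.ω₂ j x) * (localParam x)⁻¹ := by
      simp only [Pi.add_apply, Pi.smul_apply, Function.comp, lowerVec, coeffSection, Sum.elim_inr,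
        smul_eq_mul, map_mul]
      ring
    rw [h1]
    refine degLE_sum_simple_fractions Y x _ _ _ fun l hl => ?_
    rw [← h (E.enumψ.symm ⟨j, l, hl⟩)]
    congr 1
    · simp only [mulVec, dotProduct, gram, of_apply, Finset.sum_mul, comb]
      rw [Finset.sum_comm]
      refine Finset.sum_congr rfl fun y _ => ?_
      rw [Finset.mul_sum, Finset.sum_mul]
      refine Finset.sum_congr rfl fun k _ => ?_
      rw [ψ_symm]
      ring
    · rw [ψ_symm]; ring

theorem eq_zero_of_coeffSection_eq_zero {Y : Finset ℂ} {v : Fin N → ℂ}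
    (h : E.coeffSection Y v = 0) : v = 0 := by
  ext k
  obtain ⟨⟨i, l⟩, rfl⟩ := E.enumφ.symm.surjective k
  have h1 := congrFun h (.inl i)
  rw [coeffSection_inl, Pi.zero_apply] at h1
  have h2 := (map_eq_zero_iff _ (RatFunc.algebraMap_injective ℂ)).1 h1
  have h3 := congrArg (fun P : Polynomial ℂ => P.coeff l) h2
  simp only [Polynomial.finsetSum_coeff, Polynomial.coeff_C_mul, Polynomial.coeff_X_pow,
    Polynomial.coeff_zero] at h3
  rw [Finset.sum_eq_single l] at h3
  · simpa using h3
  · intro b _ hb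
    rw [if_neg (fun e => hb (Fin.ext e.symm)), mul_zero]
  · simp

variable {E}

/-- A bundle without global sections has a nonzero partition function. -/
theorem IsTrivialization.det_gram_ne_zero (hT : E.IsTrivialization Y T) :
    (E.gram Y).det ≠ 0 := by
  intro h0
  obtain ⟨v, hv, hv0⟩ := exists_mulVec_eq_zero_iff.2 h0
  apply hv
  apply E.eq_zero_of_coeffSection_eq_zero (Y := Y)
  have h1 := E.isSectionAtInfty_coeffSection (Y := Y) (v := v) (x := 0) (κ := 0) (by simp [hv0])
  rw [map_zero, zero_mul, zero_smul, add_zero, hT.2.2] at h1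
  have h2 : T *ᵥ E.coeffSection Y v = 0 := funext fun k =>
    eq_zero_of_regularAt_of_degLE
      (fun z => (hT.2.1 z _).1 (E.isSectionAt_coeffSection Y v z) k) (h1 k)
  have h3 := congrArg (T⁻¹ *ᵥ ·) h2
  simpa only [mulVec_mulVec, nonsing_inv_mul _ hT.1, one_mulVec, mulVec_zero] using h3

theorem IsTrivialization.partialSum_ne_zero (hT : E.IsTrivialization Y T) :
    E.partialSum Y ≠ 0 := by
  rw [partialSum_eq]
  exact mul_ne_zero (by exact_mod_cast N.factorial_ne_zero) hT.det_gram_ne_zero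

theorem frame_mulVec_lowerVec (Y : Finset ℂ) (z : ℂ) :
    E.frame Y z *ᵥ (RatFunc.C ∘ E.lowerVec z) = RatFunc.C ∘ E.lowerVec z := by
  ext k
  rw [frame, elemMod_mulVec, upperVec_dotProduct]
  simp [lowerVec]

theorem isSectionAt_lowerVec (Y : Finset ℂ) (x z : ℂ) :
    E.IsSectionAt Y z (RatFunc.C ∘ E.lowerVec x) := by
  rw [isSectionAt_iff, Sum.forall]
  simp_rw [frame_inv_mulVec_inl, frame_inv_mulVec_inr]
  refine ⟨fun i => regularAt_C _, fun j => ?_⟩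
  simpa [lowerVec] using regularAt_C _

/-- The rank one perturbation of the Gram matrix. -/
theorem det_gram_of_toggle {Y' : Finset ℂ} {x ε : ℂ} {v : Fin N → ℂ}
    (hY : E.gram Y' = E.gram Y + ε • vecMulVec (fun k => E.ψ k x) (fun k => E.φ k x))
    (hv : E.gram Y *ᵥ v = fun k => E.ψ k x) :
    (E.gram Y').det = (E.gram Y).det * (1 + ε * E.comb v x) := by
  have : E.gram Y' = E.gram Y * (1 + replicateCol Unit (ε • v) *
      replicateRow Unit (fun k => E.φ k x)) := by
    rw [hY, mul_add, mul_one, ← hv]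
    congr 1
    have h1 : replicateCol Unit (ε • v) * replicateRow Unit (fun k => E.φ k x) =
        ε • vecMulVec v fun k => E.φ k x := by
      ext k l; simp [mul_apply, vecMulVec_apply]; ring
    rw [h1, mul_smul_comm, mul_vecMulVec]
  rw [this, det_mul, det_one_add_replicateCol_mul_replicateRow, dotProduct_smul]
  rfl

/-- The pairing of a triple computes the quotient of the partition functions before and after the
modification. The solution `v` of `gram Y v = ψ(x)` gives a global section of `L_Y` with one
additional pole, at `x`; in the trivialization `T` it becomes a vector with a single simple pole,
which is therefore known explicitly. -/
theorem IsTrivialization.partialSum_toggle (hT : E.IsTrivialization Y T) {Y' : Finset ℂ} {x ε : ℂ}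
    (hε : ε * ε = 1)
    (hY : E.gram Y' = E.gram Y + ε • vecMulVec (fun k => E.ψ k x) (fun k => E.φ k x))
    {r s : ℂ} {τ : Triple (Fin p ⊕ Fin q)}
    (H : IsModTriple (T * E.frame Y x) x (E.lowerVec x) (E.upperVec x) ε r s τ) :
    E.partialSum Y' * (r * s) = -ε * τ.pairing * E.partialSum Y := by
  set S := T * E.frame Y x with hSdef
  have hS : LocalIso x S := hT.localIso x
  set v := (E.gram Y)⁻¹ *ᵥ fun k => E.ψ k x with hv
  have hgv : E.gram Y *ᵥ v = fun k => E.ψ k x := by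
    rw [hv, mulVec_mulVec, mul_nonsing_inv _ (isUnit_iff_ne_zero.2 hT.det_gram_ne_zero),
      one_mulVec]
  have hK := det_gram_of_toggle hY hgv
  set b := E.lowerVec x with hb
  set s₀ := E.coeffSection Y v with hs₀
  have hs₀r : ∀ z k, RegularAt z ((T *ᵥ s₀) k) := fun z =>
    (hT.2.1 z _).1 (E.isSectionAt_coeffSection Y v z)
  have hbr : ∀ z k, RegularAt z ((T *ᵥ (RatFunc.C ∘ b)) k) := fun z =>
    (hT.2.1 z _).1 (isSectionAt_lowerVec Y x z)
  have hTb : T *ᵥ (RatFunc.C ∘ b) = S *ᵥ (RatFunc.C ∘ b) := by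
    rw [hSdef, ← mulVec_mulVec, hb, frame_mulVec_lowerVec]
  have hinf : ∀ k, DegLE (-1)
      ((T *ᵥ s₀) k - (localParam x)⁻¹ * (T *ᵥ (RatFunc.C ∘ b)) k) := by
    intro k
    have h1 := E.isSectionAtInfty_coeffSection (Y := Y) (v := v) (x := x) (κ := -1)
      (by simp [hgv])
    rw [hT.2.2] at h1
    convert h1 k using 1
    rw [mulVec_add, mulVec_smul]
    simp [← hs₀, ← hb]
    ring
  -- the explicit form of the section
  have hsec : ∀ k, (T *ᵥ s₀) k = (localParam x)⁻¹ *
      ((S *ᵥ (RatFunc.C ∘ b)) k - RatFunc.C (ratVal x ((S *ᵥ (RatFunc.C ∘ b)) k))) := by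
    intro k
    set c := ratVal x ((S *ᵥ (RatFunc.C ∘ b)) k) with hc
    rw [← hTb] at hc ⊢
    have h1 : (T *ᵥ s₀) k - (localParam x)⁻¹ * (T *ᵥ (RatFunc.C ∘ b)) k +
        (localParam x)⁻¹ * RatFunc.C c = 0 := by
      refine eq_zero_of_regularAt_of_degLE (fun z => ?_) ((hinf k).add ?_)
      · have e : (T *ᵥ s₀) k - (localParam x)⁻¹ * (T *ᵥ (RatFunc.C ∘ b)) k +
            (localParam x)⁻¹ * RatFunc.C c =
            (T *ᵥ s₀) k - (localParam x)⁻¹ * ((T *ᵥ (RatFunc.C ∘ b)) k - RatFunc.C c) := by ring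
        rw [e]
        refine (hs₀r z k).sub ?_
        by_cases hz : z = x
        · subst hz
          refine ((hbr z k).sub (regularAt_C _)).div_localParam ?_
          rw [ratVal_sub (hbr z k) (regularAt_C _), ratVal_C, hc, sub_self]
        · exact (regularAt_inv_localParam hz).mul ((hbr z k).sub (regularAt_C _))
      · simpa using (degLE_inv_localParam x).mul (degLE_C c)
    linear_combination h1
  -- the regular vector `ρ` of coordinates of `s₀` in the frame at `x`
  set ρ := (E.frame Y x)⁻¹ *ᵥ s₀ with hρ
  have hρr : ∀ k, RegularAt x (ρ k) :=
    (E.isSectionAt_iff Y x s₀).1 (E.isSectionAt_coeffSection Y v x)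
  have hSρ : S *ᵥ ρ = T *ᵥ s₀ := by
    rw [hρ, mulVec_mulVec, hSdef, mul_assoc, frame_mul_inv, mul_one]
  have hSb : ∀ k, RegularAt x ((S *ᵥ (RatFunc.C ∘ b)) k) := hS.1.mulVec fun _ => regularAt_C _
  have hval : matVal x S *ᵥ (fun k => ratVal x (ρ k)) = matDeriv x S *ᵥ b := by
    ext k
    rw [← ratVal_mulVec hS.1 hρr, hSρ, hsec,
      ratVal_inv_localParam_mul ((hSb k).sub (regularAt_C _))
        (by rw [ratVal_sub (hSb k) (regularAt_C _), ratVal_C, sub_self]),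
      sub_eq_add_neg, ← map_neg, ratDeriv_add (hSb k) (regularAt_C _), ratDeriv_C, add_zero,
      ratDeriv_mulVec_C hS.1]
  have hαρ : E.upperVec x ⬝ᵥ (fun k => ratVal x (ρ k)) = E.comb v x := by
    rw [← E.sum_ratVal_coeffSection Y v x]
    simp [upperVec, dotProduct, hρ, frame_inv_mulVec_inl, ← hs₀]
  have hsK : τ.w' ⬝ᵥ (matDeriv x S *ᵥ b) = s * E.comb v x := by
    rw [← hval, dotProduct_mulVec, ← mulVec_transpose, H.w'_eq, smul_dotProduct, hαρ, smul_eq_mul]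
  rw [partialSum_eq, partialSum_eq, hK, H.pairing_eq, hsK]
  linear_combination (-(N.factorial : ℂ) * (E.gram Y).det * r * s) * hε

end Ensemble

/-! ### Moving the endpoints of segments -/

section Segments

theorem mem_integralSegment_iff {a b : ℂ} {k : ℕ} (h : b - a = k) (z : ℂ) :
    z ∈ integralSegment a b ↔ ∃ j ≤ k, z = a + (j : ℕ) := by
  constructor
  · rintro ⟨j, l, hz, hb⟩
    have : ((j + l : ℕ) : ℂ) = k := by rw [← h, hb, hz]; push_cast; ring
    exact ⟨j, by have := Nat.cast_injective this; omega, hz⟩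
  · rintro ⟨j, hj, rfl⟩
    refine ⟨j, k - j, rfl, ?_⟩
    rw [Nat.cast_sub hj, ← h]; ring

theorem integralSegment_add_one {a b : ℂ} {k : ℕ} (h : b - a = k) :
    integralSegment a (b + 1) = insert (b + 1) (integralSegment a b) ∧
      b + 1 ∉ integralSegment a b := by
  have hb : b = a + k := by rw [← h]; ring
  have h' : b + 1 - a = ((k + 1 : ℕ) : ℂ) := by push_cast; rw [← h]; ring
  constructor
  · ext z
    rw [Set.mem_insert_iff, mem_integralSegment_iff h, mem_integralSegment_iff h']
    constructor
    · rintro ⟨j, hj, rfl⟩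
      rcases Nat.lt_or_ge k j with hlt | hle
      · left
        obtain rfl : j = k + 1 := by omega
        rw [hb]; push_cast; ring
      · exact Or.inr ⟨j, hle, rfl⟩
    · rintro (rfl | ⟨j, hj, rfl⟩)
      · exact ⟨k + 1, le_rfl, by rw [hb]; push_cast; ring⟩
      · exact ⟨j, by omega, rfl⟩
  · rw [mem_integralSegment_iff h]
    rintro ⟨j, hj, hz⟩
    have : ((k + 1 : ℕ) : ℂ) = j := by
      rw [hb] at hz; push_cast; linear_combination hz
    have := Nat.cast_injective this
    omega

theorem integralSegment_sub_one {a b : ℂ} {k : ℕ} (h : b - a = k) :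
    integralSegment (a - 1) b = insert (a - 1) (integralSegment a b) ∧
      a - 1 ∉ integralSegment a b := by
  have h' : b - (a - 1) = ((k + 1 : ℕ) : ℂ) := by push_cast; rw [← h]; ring
  constructor
  · ext z
    rw [Set.mem_insert_iff, mem_integralSegment_iff h, mem_integralSegment_iff h']
    constructor
    · rintro ⟨j, hj, rfl⟩
      rcases j with _ | j
      · left; simp
      · exact Or.inr ⟨j, by omega, by push_cast; ring⟩
    · rintro (rfl | ⟨j, hj, rfl⟩)
      · exact ⟨0, by omega, by simp⟩
      · exact ⟨j + 1, by omega, by push_cast; ring⟩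
  · rw [mem_integralSegment_iff h]
    rintro ⟨j, hj, hz⟩
    have : ((j + 1 : ℕ) : ℂ) = (0 : ℕ) := by push_cast; linear_combination -hz
    have := Nat.cast_injective this
    omega

/-- Whether the move of an endpoint shortens its segment, so that a point is added to the
complement. -/
def IsShortening {r : ℕ} : Endpoint r → Dir → Prop
  | .inl _, .up => True
  | .inl _, .down => False
  | .inr _, .up => False
  | .inr _, .down => True

theorem move_move_comm {r : ℕ} (c : Endpoint r → ℂ) (e f : Endpoint r) (d d' : Dir) :
    move (move c e d) f d' = move (move c f d') e d := by
  simp only [move]; abel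

theorem modifiedPoint_move_of_ne {r : ℕ} (c : Endpoint r → ℂ) {e f : Endpoint r} (h : e ≠ f)
    (d d' : Dir) : modifiedPoint (move c f d') e d = modifiedPoint c e d := by
  have h1 : move c f d' e = c e := by simp [move, Pi.single_eq_of_ne h]
  rcases e with i | i <;> cases d <;> simp [modifiedPoint, singularPoint, h1]

theorem modifiedPoint_move_self {r : ℕ} (c : Endpoint r → ℂ) (e : Endpoint r) (d d' : Dir) :
    modifiedPoint (move c e d') e d = modifiedPoint c e d + d'.val := by
  have h1 : move c e d' e = c e + d'.val := by simp [move]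
  rcases e with i | i <;> cases d <;> simp [modifiedPoint, singularPoint, h1] <;> ring

end Segments

namespace Ensemble

variable {p q N r : ℕ} {E : Ensemble p q N}

theorem mem_complement {c : Endpoint r → ℂ} {x : ℂ} : x ∈ E.complement c ↔
    x ∈ E.X ∧ ∀ i, x ∉ integralSegment (c (.inl i)) (c (.inr i)) := by
  simp [complement]

theorem complement_of_insert {c c' : Endpoint r → ℂ} {i : Fin r} {x : ℂ}
    (hc' : E.Admissible c')
    (hne : ∀ j, j ≠ i → integralSegment (c' (.inl j)) (c' (.inr j)) =
      integralSegment (c (.inl j)) (c (.inr j)))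
    (hi : integralSegment (c' (.inl i)) (c' (.inr i)) =
      insert x (integralSegment (c (.inl i)) (c (.inr i))))
    (hx : x ∉ integralSegment (c (.inl i)) (c (.inr i))) :
    x ∈ E.X ∧ x ∈ E.complement c ∧ x ∉ E.complement c' ∧
      ∀ z, z ≠ x → (z ∈ E.complement c ↔ z ∈ E.complement c') := by
  have hx' : x ∈ integralSegment (c' (.inl i)) (c' (.inr i)) := by rw [hi]; exact Set.mem_insert _ _
  have hxX : x ∈ E.X := hc'.2.1 i hx'
  refine ⟨hxX, ?_, ?_, ?_⟩
  · refine mem_complement.2 ⟨hxX, fun j => ?_⟩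
    by_cases hj : j = i
    · subst hj; exact hx
    · rw [← hne j hj]
      exact fun h => Set.disjoint_left.1 (hc'.2.2 j i hj) h hx'
  · exact fun h => (mem_complement.1 h).2 i hx'
  · intro z hz
    rw [mem_complement, mem_complement]
    refine and_congr_right fun _ => forall_congr' fun j => not_congr ?_
    by_cases hj : j = i
    · subst hj; rw [hi, Set.mem_insert_iff, or_iff_right hz]
    · rw [hne j hj]

/-- Moving an endpoint adds one point to the complement or removes one point from it. -/
theorem complement_move {c : Endpoint r → ℂ} {e : Endpoint r} {d : Dir} (hc : E.Admissible c)
    (hm : E.Admissible (move c e d)) :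
    modifiedPoint c e d ∈ E.X ∧
      (modifiedPoint c e d ∈ E.complement c ↔ ¬ IsShortening e d) ∧
      (modifiedPoint c e d ∈ E.complement (move c e d) ↔ IsShortening e d) ∧
      ∀ z, z ≠ modifiedPoint c e d →
        (z ∈ E.complement c ↔ z ∈ E.complement (move c e d)) := by
  set c' := move c e d with hc'
  have hsame : ∀ f, f ≠ e → c' f = c f := fun f hf => by simp [hc', move, Pi.single_eq_of_ne hf]
  have hself : c' e = c e + d.val := by simp [hc', move]
  rcases e with i | i <;> cases d <;> simp only [Dir.val] at hself <;>
    simp only [modifiedPoint, singularPoint, IsShortening]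
  · obtain ⟨k, -, hk⟩ := hm.1 i
    have h1 := integralSegment_sub_one hk
    have h2 : c' (.inl i) - 1 = c (.inl i) := by rw [hself]; ring
    have h3 : c' (.inr i) = c (.inr i) := hsame _ (by simp)
    rw [h2] at h1
    have := complement_of_insert (c := c') (c' := c) (i := i) (x := c (.inl i)) hc
      (fun j hj => by rw [hsame _ (by simpa using hj), hsame _ (by simp)])
      (by rw [← h1.1, h3]) h1.2
    simp only [sub_add_cancel]
    exact ⟨this.1, by simp [this.2.2.1], by simp [this.2.1], fun z hz => (this.2.2.2 z hz).symm⟩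
  · obtain ⟨k, -, hk⟩ := hc.1 i
    have h1 := integralSegment_sub_one hk
    have h2 : c' (.inl i) = c (.inl i) - 1 := by rw [hself]; ring
    have h3 : c' (.inr i) = c (.inr i) := hsame _ (by simp)
    have := complement_of_insert (c := c) (c' := c') (i := i) (x := c (.inl i) - 1) hm
      (fun j hj => by rw [hsame _ (by simpa using hj), hsame _ (by simp)])
      (by rw [h2, h3, h1.1]) h1.2
    exact ⟨this.1, by simp [this.2.1], by simp [this.2.2.1], this.2.2.2⟩
  · obtain ⟨k, -, hk⟩ := hc.1 i
    have h1 := integralSegment_add_one hk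
    have h3 : c' (.inl i) = c (.inl i) := hsame _ (by simp)
    have := complement_of_insert (c := c) (c' := c') (i := i) (x := c (.inr i) + 1) hm
      (fun j hj => by rw [hsame _ (by simp), hsame _ (by simpa using hj)])
      (by rw [hself, h3, h1.1]) h1.2
    exact ⟨this.1, by simp [this.2.1], by simp [this.2.2.1], this.2.2.2⟩
  · obtain ⟨k, -, hk⟩ := hm.1 i
    have h1 := integralSegment_add_one hk
    have h2 : c' (.inr i) + 1 = c (.inr i) := by rw [hself]; ring
    have h3 : c' (.inl i) = c (.inl i) := hsame _ (by simp)
    rw [h2] at h1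
    have := complement_of_insert (c := c') (c' := c) (i := i) (x := c (.inr i)) hc
      (fun j hj => by rw [hsame _ (by simp), hsame _ (by simpa using hj)])
      (by rw [← h1.1, h3]) h1.2
    exact ⟨this.1, by simp [this.2.2.1], by simp [this.2.1], fun z hz => (this.2.2.2 z hz).symm⟩

/-- At a singular point `u` exactly one of `u`, `u + 1` lies in the complement. -/
theorem singularPoint_mem {c : Endpoint r → ℂ} {e : Endpoint r} (hc : E.Admissible c)
    (he : outerNeighbour c e ∈ E.complement c) :
    singularPoint c e ∈ E.X ∧ singularPoint c e + 1 ∈ E.X ∧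
      (singularPoint c e + 1 ∈ E.complement c ↔ singularPoint c e ∉ E.complement c) := by
  have hX := (mem_complement.1 he).1
  rcases e with i | i <;> simp only [outerNeighbour, singularPoint, sub_add_cancel] at *
  · obtain ⟨k, -, hk⟩ := hc.1 i
    have h1 : c (.inl i) ∈ integralSegment (c (.inl i)) (c (.inr i)) :=
      (mem_integralSegment_iff hk _).2 ⟨0, by omega, by simp⟩
    refine ⟨hX, hc.2.1 i h1, ?_⟩
    simp only [he, not_true_eq_false, iff_false]
    exact fun h => (mem_complement.1 h).2 i h1
  · obtain ⟨k, -, hk⟩ := hc.1 i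
    have h1 : c (.inr i) ∈ integralSegment (c (.inl i)) (c (.inr i)) :=
      (mem_integralSegment_iff hk _).2 ⟨k, le_rfl, by rw [← hk]; ring⟩
    refine ⟨hc.2.1 i h1, hX, ?_⟩
    simp only [he, true_iff]
    exact fun h => (mem_complement.1 h).2 i h1

end Ensemble

namespace Ensemble

/-! ### Adding a point to `Y` or removing one -/

section Toggle

variable {p q N : ℕ} {E : Ensemble p q N} {Y Y' : Finset ℂ} {x : ℂ}

/-- `Y'` differs from `Y` exactly at the point `x` of the phase space. -/
def IsToggle (E : Ensemble p q N) (Y Y' : Finset ℂ) (x : ℂ) : Prop :=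
  x ∈ E.X ∧ (x ∈ Y' ↔ x ∉ Y) ∧ ∀ z, z ≠ x → (z ∈ Y ↔ z ∈ Y')

/-- `1` if toggling `x` adds it to `Y`, and `-1` if it removes it. -/
def toggleSign (Y : Finset ℂ) (x : ℂ) : ℂ := 1 - 2 * indicator Y x

theorem indicator_of_mem (h : x ∈ Y) : indicator Y x = 1 := by simp [indicator, h]

theorem indicator_of_notMem (h : x ∉ Y) : indicator Y x = 0 := by simp [indicator, h]

theorem toggleSign_of_mem (h : x ∈ Y) : toggleSign Y x = -1 := by
  rw [toggleSign, indicator_of_mem h]; norm_num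

theorem toggleSign_of_notMem (h : x ∉ Y) : toggleSign Y x = 1 := by
  rw [toggleSign, indicator_of_notMem h]; norm_num

theorem toggleSign_mul_self (Y : Finset ℂ) (x : ℂ) : toggleSign Y x * toggleSign Y x = 1 := by
  by_cases h : x ∈ Y
  · rw [toggleSign_of_mem h]; norm_num
  · rw [toggleSign_of_notMem h]; norm_num

theorem toggleSign_ne_zero (Y : Finset ℂ) (x : ℂ) : toggleSign Y x ≠ 0 := fun h => by
  have := toggleSign_mul_self Y x
  simp [h] at this

theorem IsToggle.indicator_eq (h : IsToggle E Y Y' x) :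
    indicator Y' x = indicator Y x + toggleSign Y x := by
  by_cases hx : x ∈ Y
  · rw [toggleSign_of_mem hx, indicator_of_mem hx,
      indicator_of_notMem fun h' => h.2.1.1 h' hx]; norm_num
  · rw [toggleSign_of_notMem hx, indicator_of_notMem hx, indicator_of_mem (h.2.1.2 hx)]; norm_num

theorem IsToggle.frame_self (h : IsToggle E Y Y' x) : E.frame Y' x =
    E.frame Y x * elemMod x (toggleSign Y x) (E.lowerVec x) (E.upperVec x) := by
  rw [frame, frame, elemMod_mul x _ _ (E.upperVec_dotProduct_lowerVec x x), h.indicator_eq]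

theorem frame_congr {z : ℂ} (h : z ∈ Y ↔ z ∈ Y') : E.frame Y' z = E.frame Y z := by
  simp only [frame, indicator, h]

theorem IsToggle.gram_eq (h : IsToggle E Y Y' x) : E.gram Y' = E.gram Y +
    toggleSign Y x • vecMulVec (fun k => E.ψ k x) (fun k => E.φ k x) := by
  classical
  have key : ∀ {W W' : Finset ℂ}, x ∉ W → x ∈ W' → (∀ z, z ≠ x → (z ∈ W ↔ z ∈ W')) →
      E.gram W' = E.gram W + vecMulVec (fun k => E.ψ k x) (fun k => E.φ k x) := by
    intro W W' h1 h2 h3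
    have : W' = insert x W := by
      ext z
      by_cases hz : z = x
      · subst hz; simp [h2]
      · simp [hz, h3 z hz]
    ext k l
    simp [gram, this, h1, vecMulVec_apply, add_comm]
  by_cases hx : x ∈ Y
  · rw [key (fun h' => h.2.1.1 h' hx) hx fun z hz => (h.2.2 z hz).symm, toggleSign_of_mem hx,
      neg_smul, one_smul, add_neg_cancel_right]
  · rw [key hx (h.2.1.2 hx) h.2.2, toggleSign_of_notMem hx, one_smul]

variable {T : Matrix (Fin p ⊕ Fin q) (Fin p ⊕ Fin q) (RatFunc ℂ)} {r s : ℂ}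
  {τ : Triple (Fin p ⊕ Fin q)}

/-- Both sides are proportional, with a nonzero factor, since `partialSum Y ≠ 0`. -/
theorem IsTrivialization.pairing_ne_zero_iff (hT : E.IsTrivialization Y T)
    (h : IsToggle E Y Y' x) (H : IsModTriple (T * E.frame Y x) x (E.lowerVec x) (E.upperVec x)
      (toggleSign Y x) r s τ) : τ.pairing ≠ 0 ↔ E.partialSum Y' ≠ 0 := by
  have h1 := hT.partialSum_toggle (toggleSign_mul_self Y x) h.gram_eq H
  have h2 := hT.partialSum_ne_zero
  have h3 : r * s ≠ 0 := mul_ne_zero H.r_ne H.s_ne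
  have h4 := toggleSign_ne_zero Y x
  refine not_congr ⟨fun h0 => ?_, fun h0 => ?_⟩
  · rw [h0] at h1; simpa [h3] using h1
  · rw [h0] at h1; simpa [h2, h4] using h1

theorem IsTrivialization.gauge_mul (hT : E.IsTrivialization Y T) (h : IsToggle E Y Y' x)
    (H : IsModTriple (T * E.frame Y x) x (E.lowerVec x) (E.upperVec x) (toggleSign Y x) r s τ)
    (hP : τ.pairing ≠ 0) : E.IsTrivialization Y' (τ.gauge x * T) := by
  have hab := E.upperVec_dotProduct_lowerVec x x
  have hww : τ.w' ⬝ᵥ τ.w = 0 := by rw [dotProduct_comm]; exact H.w_dotProduct_w' hab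
  have hg : τ.gauge x = elemMod x τ.pairing⁻¹ τ.w τ.w' := rfl
  refine ⟨?_, fun z s => isSectionAt_iff_of_localIso ?_ s, fun s => ?_⟩
  · rw [det_mul, hg, det_elemMod x _ hww, one_mul]; exact hT.1
  · by_cases hz : z = x
    · subst hz
      have := H.localIso_gauge (hT.localIso z) (toggleSign_mul_self Y z) hab hP
      rwa [h.frame_self, mul_assoc (τ.gauge z), ← mul_assoc T, ← mul_assoc (τ.gauge z)]
    · rw [frame_congr (h.2.2 z hz), mul_assoc, hg]
      exact (localIso_elemMod hz _ hww).mul (hT.localIso z)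
  · rw [hT.2.2, ← mulVec_mulVec, hg]
    refine ⟨fun hs => degLE_elemMod_mulVec x _ _ _ hs, fun hs => ?_⟩
    have := degLE_elemMod_mulVec x (-τ.pairing⁻¹) τ.w τ.w' hs
    rwa [mulVec_mulVec, elemMod_mul x _ _ hww, neg_add_cancel, elemMod_zero, one_mulVec] at this

/-- The gauge matrix of any triple of the modification provides the trivialization. -/
theorem IsTrivialization.exists_of_toggle (hq : 0 < q) (hT : E.IsTrivialization Y T)
    (h : IsToggle E Y Y' x) (hY' : E.partialSum Y' ≠ 0) : ∃ T', E.IsTrivialization Y' T' := by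
  obtain ⟨τ, H⟩ := exists_isModTriple (a := E.upperVec x) (hT.localIso x)
    (E.lowerVec_ne_zero hq h.1) (toggleSign Y x)
  exact ⟨_, hT.gauge_mul h H ((hT.pairing_ne_zero_iff h H).2 hY')⟩

end Toggle

/-! ### The d-connection in local frames -/

section Connection

variable {p q N : ℕ} {E : Ensemble p q N} {x y z : ℂ}
  {V : Matrix (Fin p ⊕ Fin q) (Fin p ⊕ Fin q) (RatFunc ℂ)}

theorem upperVec_mul_lowerVec (x y : ℂ) (k : Fin p ⊕ Fin q) :
    E.upperVec x k * E.lowerVec y k = 0 := by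
  rcases k with i | j <;> simp [upperVec, lowerVec]

/-- `V` is a diagonal matrix, regular and invertible at `z`, whose value there carries the polar
parts of the sections at `x` to those at `y`. -/
structure Carries (E : Ensemble p q N) (V : Matrix (Fin p ⊕ Fin q) (Fin p ⊕ Fin q) (RatFunc ℂ))
    (z x y : ℂ) : Prop where
  isDiag : V.IsDiag
  localIso : LocalIso z V
  lower : matVal z V *ᵥ E.lowerVec x = E.lowerVec y
  upper : (matVal z V)ᵀ *ᵥ E.upperVec y = E.upperVec x

theorem Carries.inv (h : Carries E V z x y) : Carries E V⁻¹ z y x := by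
  refine ⟨?_, h.localIso.inv, ?_, ?_⟩
  · rw [← (isDiag_iff_diagonal_diag V).1 h.isDiag, inv_diagonal]
    exact isDiag_diagonal _
  · rw [← h.lower, mulVec_mulVec, h.localIso.matVal_inv_mul, one_mulVec]
  · rw [← h.upper, mulVec_mulVec, ← transpose_mul, h.localIso.matVal_mul_inv, transpose_one,
      one_mulVec]

theorem Carries.shift {h : ℂ} (H : Carries E V (z + h) x y) :
    Carries E (V.map (shift h)) z x y := by
  refine ⟨H.isDiag.map (map_zero _), H.localIso.shift, ?_, ?_⟩
  · rw [matVal_shift H.localIso.1, H.lower]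
  · rw [matVal_shift H.localIso.1, H.upper]

theorem Carries.upper_matDeriv_lower (H : Carries E V z x y) :
    E.upperVec y ⬝ᵥ (matDeriv z V *ᵥ E.lowerVec x) = 0 := by
  refine Finset.sum_eq_zero fun k _ => ?_
  have : (matDeriv z V *ᵥ E.lowerVec x) k = ratDeriv z (V k k) * E.lowerVec x k := by
    rw [mulVec, dotProduct, Finset.sum_eq_single k]
    · rfl
    · intro l _ hl
      rw [matDeriv_apply, H.isDiag hl.symm]; simp
    · simp
  rw [this, mul_left_comm, upperVec_mul_lowerVec, mul_zero]

theorem carries_diagConnection {ϖ₁ : Fin p → RatFunc ℂ} {ϖ₂ : Fin q → RatFunc ℂ}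
    (hϖ₁ : ∀ i, ∀ x ∈ E.X, x + 1 ∈ E.X → E.ω₁ i (x + 1) / E.ω₁ i x = ratVal x (ϖ₁ i))
    (hϖ₂ : ∀ i, ∀ x ∈ E.X, x + 1 ∈ E.X → E.ω₂ i (x + 1) / E.ω₂ i x = ratVal x (ϖ₂ i))
    {u : ℂ} (hu : u ∈ E.X) (hu' : u + 1 ∈ E.X) :
    Carries E (diagConnection ϖ₁ ϖ₂) u u (u + 1) := by
  have h1 : ∀ i, ratVal u (ϖ₁ i) ≠ 0 := fun i => by
    rw [← hϖ₁ i u hu hu']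
    exact div_ne_zero (E.ω₁_ne_zero i _ hu') (E.ω₁_ne_zero i _ hu)
  have h2 : ∀ i, ratVal u (ϖ₂ i) ≠ 0 := fun i => by
    rw [← hϖ₂ i u hu hu']
    exact div_ne_zero (E.ω₂_ne_zero i _ hu') (E.ω₂_ne_zero i _ hu)
  -- a nonzero value excludes a pole, where the value would be `0`
  have h3 : ∀ k, ratVal u (Sum.elim (fun i => (ϖ₁ i)⁻¹) ϖ₂ k) ≠ 0 := by
    rintro (i | j)
    · simp [ratVal_inv (h1 i), h1 i]
    · simpa using h2 j
  have h4 : ∀ k, RegularAt u (Sum.elim (fun i => (ϖ₁ i)⁻¹) ϖ₂ k) := fun k =>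
    regularAt_of_ratVal_ne_zero (h3 k)
  have hval : matVal u (diagConnection ϖ₁ ϖ₂) =
      diagonal fun k => ratVal u (Sum.elim (fun i => (ϖ₁ i)⁻¹) ϖ₂ k) := by
    rw [matVal, diagConnection, diagonal_map (ratVal_zero u)]
  refine ⟨isDiag_diagonal _, ⟨fun i j => ?_, ?_⟩, ?_, ?_⟩
  · rw [diagConnection, diagonal_apply]
    split_ifs
    exacts [h4 i, regularAt_zero]
  · rw [diagConnection, det_diagonal, ratVal_prod _ _ fun k _ => h4 k]
    exact Finset.prod_ne_zero_iff.2 fun k _ => h3 k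
  · rw [hval]
    ext k
    rw [mulVec_diagonal]
    rcases k with i | j
    · simp [lowerVec]
    · simp only [lowerVec, Sum.elim_inr, ← hϖ₂ j u hu hu']
      exact div_mul_cancel₀ _ (E.ω₂_ne_zero j _ hu)
  · rw [hval, diagonal_transpose]
    ext k
    rw [mulVec_diagonal]
    rcases k with i | j
    · have := E.ω₁_ne_zero i _ hu
      have := E.ω₁_ne_zero i _ hu'
      simp only [upperVec, Sum.elim_inl, ratVal_inv (h1 i), ← hϖ₁ i u hu hu']
      field_simp
    · simp [upperVec]

/-- The matrix that a diagonal isomorphism has in the frames of two bundles, which both have the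
prescribed poles (`c = 1`) or both are regular (`c = 0`). -/
theorem Carries.conj (H : Carries E V z x y) (c : ℂ) {W : Matrix _ _ (RatFunc ℂ)}
    (hW : W = elemMod z (-c) (E.lowerVec y) (E.upperVec y) * V *
      elemMod z c (E.lowerVec x) (E.upperVec x)) :
    LocalIso z W ∧ matVal z W *ᵥ E.lowerVec x = E.lowerVec y ∧
      (matVal z W)ᵀ *ᵥ E.upperVec y = E.upperVec x ∧
      E.upperVec y ⬝ᵥ (matDeriv z W *ᵥ E.lowerVec x) = 0 := by
  obtain ⟨f, hf⟩ : ∃ f, V = diagonal f := ⟨V.diag, ((isDiag_iff_diagonal_diag V).1 H.isDiag).symm⟩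
  have hfr : ∀ k, RegularAt z (f k) := fun k => by
    have := H.localIso.1 k k
    rwa [hf, diagonal_apply_eq] at this
  have hval : matVal z V = diagonal fun k => ratVal z (f k) := by
    rw [matVal, hf, diagonal_map (ratVal_zero z)]
  have hlow : ∀ k, ratVal z (f k) * E.lowerVec x k = E.lowerVec y k := fun k => by
    rw [← congrFun H.lower k, hval, mulVec_diagonal]
  have hupp : ∀ k, ratVal z (f k) * E.upperVec y k = E.upperVec x k := fun k => by
    rw [← congrFun H.upper k, hval, diagonal_transpose, mulVec_diagonal]
  have hzero : ∀ a b : ℂ, ∀ k, (RatFunc.C (E.upperVec a k) : RatFunc ℂ) *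
      RatFunc.C (E.lowerVec b k) = 0 := fun a b k => by
    rw [← map_mul, upperVec_mul_lowerVec, map_zero]
  have hC : ∀ a b : ℂ, (RatFunc.C ∘ E.upperVec a) ⬝ᵥ (RatFunc.C ∘ E.lowerVec b) = 0 := fun a b =>
    Finset.sum_eq_zero fun k _ => hzero a b k
  have hVl : ∀ k, (V *ᵥ (RatFunc.C ∘ E.lowerVec x)) k = f k * RatFunc.C (E.lowerVec x k) :=
    fun k => by rw [hf, mulVec_diagonal]; rfl
  have hVu : ∀ k, (Vᵀ *ᵥ (RatFunc.C ∘ E.upperVec y)) k = f k * RatFunc.C (E.upperVec y k) :=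
    fun k => by rw [hf, diagonal_transpose, mulVec_diagonal]; rfl
  -- the products with the polar directions are those of `V`
  have hWb : ∀ k, ((elemMod z (-c) (E.lowerVec y) (E.upperVec y) * V) *ᵥ
      (RatFunc.C ∘ E.lowerVec x)) k = f k * RatFunc.C (E.lowerVec x k) := fun k => by
    rw [← mulVec_mulVec, elemMod_mulVec, dotProduct_mulVec, ← mulVec_transpose, hVl, dotProduct,
      Finset.sum_eq_zero fun l _ => by
        rw [hVu, mul_assoc, Function.comp, hzero, mul_zero]]
    simp
  have hWb' : W *ᵥ (RatFunc.C ∘ E.lowerVec x) = fun k => f k * RatFunc.C (E.lowerVec x k) := by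
    have h1 : elemMod z c (E.lowerVec x) (E.upperVec x) *ᵥ (RatFunc.C ∘ E.lowerVec x) =
        RatFunc.C ∘ E.lowerVec x := by
      ext k
      rw [elemMod_mulVec, hC]
      simp
    rw [hW, ← mulVec_mulVec, h1]
    exact funext hWb
  have hWa : Wᵀ *ᵥ (RatFunc.C ∘ E.upperVec y) = fun k => f k * RatFunc.C (E.upperVec y k) := by
    have h1 : elemMod z (-c) (E.upperVec y) (E.lowerVec y) *ᵥ (RatFunc.C ∘ E.upperVec y) =
        RatFunc.C ∘ E.upperVec y := by
      ext k
      rw [elemMod_mulVec, dotProduct_comm, hC]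
      simp
    rw [hW, transpose_mul, transpose_mul, elemMod_transpose, elemMod_transpose, ← mulVec_mulVec,
      ← mulVec_mulVec, h1]
    ext k
    rw [elemMod_mulVec, dotProduct, Finset.sum_eq_zero fun l _ => by
        rw [hVu, mul_left_comm, Function.comp, mul_comm (RatFunc.C _), hzero, mul_zero], hVu]
    simp
  have hreg : MatRegular z W := fun i j => by
    have h1 : (elemMod z (-c) (E.lowerVec y) (E.upperVec y) * V) i j = V i j + (localParam z)⁻¹ *
        (RatFunc.C (-c * E.lowerVec y i) * (f j * RatFunc.C (E.upperVec y j))) := by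
      have h2 : (elemMod z (-c) (E.lowerVec y) (E.upperVec y) * V) i j =
          (elemMod z (-c) (E.lowerVec y) (E.upperVec y) *ᵥ fun k => V k j) i := rfl
      have h3 : (RatFunc.C ∘ E.upperVec y) ⬝ᵥ (fun k => V k j) =
          (Vᵀ *ᵥ (RatFunc.C ∘ E.upperVec y)) j := dotProduct_comm _ _
      rw [h2, elemMod_mulVec, h3, hVu]
    have h4 : W i j = V i j + (localParam z)⁻¹ *
        (RatFunc.C (c * E.upperVec x j * E.lowerVec x i) * f i +
          RatFunc.C (-c * E.lowerVec y i * E.upperVec y j) * f j) := by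
      rw [hW, mul_elemMod_apply, hWb, h1]
      simp only [map_mul]
      ring
    have h5 : ∀ a k, RegularAt z (RatFunc.C a * f k) := fun a k => (regularAt_C a).mul (hfr k)
    rw [h4]
    refine (H.localIso.1 i j).add (((h5 _ _).add (h5 _ _)).div_localParam ?_)
    rw [ratVal_add (h5 _ _) (h5 _ _), ratVal_mul (regularAt_C _) (hfr i),
      ratVal_mul (regularAt_C _) (hfr j), ratVal_C, ratVal_C]
    -- the residue is `c (V(z) b aᵗ - b' a'ᵗ V(z)) = 0`
    linear_combination c * E.upperVec x j * hlow i - c * E.lowerVec y i * hupp j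
  refine ⟨⟨hreg, ?_⟩, ?_, ?_, ?_⟩
  · rw [hW, det_mul, det_mul, det_elemMod z _ (E.upperVec_dotProduct_lowerVec y y),
      det_elemMod z _ (E.upperVec_dotProduct_lowerVec x x), one_mul, mul_one]
    exact H.localIso.2
  · ext k
    rw [← ratVal_mulVec_C hreg, hWb', ratVal_mul (hfr k) (regularAt_C _), ratVal_C, hlow]
  · ext k
    rw [← matVal_transpose, ← ratVal_mulVec_C hreg.transpose, hWa,
      ratVal_mul (hfr k) (regularAt_C _), ratVal_C, hupp]
  · refine Finset.sum_eq_zero fun k _ => ?_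
    rw [← ratDeriv_mulVec_C hreg, hWb', ratDeriv_mul (hfr k) (regularAt_C _), ratVal_C, ratDeriv_C,
      mul_zero, add_zero, mul_left_comm, upperVec_mul_lowerVec, mul_zero]

end Connection

end Ensemble

theorem map_shift_inv {ι : Type} [Fintype ι] [DecidableEq ι] (h : ℂ)
    {M : Matrix ι ι (RatFunc ℂ)} (hM : IsUnit M.det) :
    (M.map (shift h))⁻¹ = M⁻¹.map (shift h) := by
  refine inv_eq_right_inv ?_
  rw [← Matrix.map_mul, mul_nonsing_inv _ hM, Matrix.map_one _ (map_zero _) (map_one _)]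

namespace Ensemble

variable {p q N : ℕ} {E : Ensemble p q N} {Y : Finset ℂ} {u : ℂ}
  {𝒜 T A : Matrix (Fin p ⊕ Fin q) (Fin p ⊕ Fin q) (RatFunc ℂ)}

/-! ### Singularities and triples of the matrix of the d-connection -/

/-- The frame at `z + h`, translated to `z`. -/
theorem shift_frame (Y : Finset ℂ) (z h : ℂ) : (E.frame Y (z + h)).map (shift h) =
    elemMod z (indicator Y (z + h)) (E.lowerVec (z + h)) (E.upperVec (z + h)) :=
  shift_elemMod h z _ _ _

theorem map_shift_eq (Y : Finset ℂ) (z h : ℂ)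
    (T : Matrix (Fin p ⊕ Fin q) (Fin p ⊕ Fin q) (RatFunc ℂ)) :
    T.map (shift h) = (T * E.frame Y (z + h)).map (shift h) *
      elemMod z (-indicator Y (z + h)) (E.lowerVec (z + h)) (E.upperVec (z + h)) := by
  rw [Matrix.map_mul, shift_frame, mul_assoc,
    elemMod_mul z _ _ (E.upperVec_dotProduct_lowerVec _ _), add_neg_cancel, elemMod_zero, mul_one]

theorem inv_eq_frame_mul (Y : Finset ℂ) (z : ℂ)
    (T : Matrix (Fin p ⊕ Fin q) (Fin p ⊕ Fin q) (RatFunc ℂ)) :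
    T⁻¹ = E.frame Y z * (T * E.frame Y z)⁻¹ := by
  rw [Matrix.mul_inv_rev, ← mul_assoc, frame_mul_inv, one_mul]

/-- At a point `u` such that exactly one of `u`, `u + 1` lies in `Y`, the matrix `A` has the
singularity of an elementary modification, and its triples are the triples of the modifications of
`L_Y` at `u + 1` and at `u`. -/
theorem IsTrivialization.singularity (hp : 0 < p) (hq : 0 < q) (hT : E.IsTrivialization Y T)
    (hA : A = connectionMatrix 𝒜 T) (h𝒜 : Carries E 𝒜 u u (u + 1)) (hu : u ∈ E.X)
    (hu' : u + 1 ∈ E.X) (hY : u + 1 ∈ Y ↔ u ∉ Y) :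
    HasSingularity A u ∧ (∀ d, ∃ τ, IsTriple A u d τ) ∧
      (∀ τ, IsTriple A u .up τ → ∃ r s, IsModTriple (T * E.frame Y (u + 1)) (u + 1)
        (E.lowerVec (u + 1)) (E.upperVec (u + 1)) (toggleSign Y (u + 1)) r s τ) ∧
      ∀ τ, IsTriple A u .down τ → ∃ r s, IsModTriple (T * E.frame Y u) u
        (E.lowerVec u) (E.upperVec u) (toggleSign Y u) r s τ := by
  have hab := E.upperVec_dotProduct_lowerVec u u
  have hab' := E.upperVec_dotProduct_lowerVec (u + 1) (u + 1)
  have ha := E.upperVec_ne_zero hp hu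
  have ha' := E.upperVec_ne_zero hp hu'
  have hb := E.lowerVec_ne_zero hq hu
  have hb' := E.lowerVec_ne_zero hq hu'
  have hS := hT.localIso u
  have hS' := hT.localIso (u + 1)
  have hS₁ := hS'.shift
  -- the matrix in the frames of `L_Y` at `u` and `u + 1`
  have hAeq : A = (T * E.frame Y (u + 1)).map (shift 1) *
      elemMod u (-indicator Y (u + 1)) (E.lowerVec (u + 1)) (E.upperVec (u + 1)) * 𝒜 *
        (elemMod u (indicator Y u) (E.lowerVec u) (E.upperVec u) * (T * E.frame Y u)⁻¹) := by
    rw [hA, connectionMatrix, map_shift_eq (E := E) Y u 1 T, inv_eq_frame_mul (E := E) Y u T]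
    rfl
  set S := T * E.frame Y u
  clear_value S
  set S₁ := (T * E.frame Y (u + 1)).map (shift 1)
  by_cases hmem : u ∈ Y
  · have hmem' : u + 1 ∉ Y := fun h => hY.1 h hmem
    rw [toggleSign_of_mem hmem, toggleSign_of_notMem hmem']
    rw [indicator_of_mem hmem, indicator_of_notMem hmem', neg_zero, elemMod_zero, mul_one,
      ← mul_assoc] at hAeq
    have hAinv : A⁻¹ = S * elemMod u (-1) (E.lowerVec u) (E.upperVec u) * (𝒜⁻¹ * S₁⁻¹) := by
      rw [hAeq, Matrix.mul_inv_rev, Matrix.mul_inv_rev, Matrix.mul_inv_rev,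
        nonsing_inv_nonsing_inv _ hS.isUnit_det, elemMod_inv u _ hab, ← mul_assoc]
    have hup := fun τ => isTriple_iff (τ := τ) (A := A) (d := .up) (hS₁.mul h𝒜.localIso) hS.inv
      (one_mul 1) ha hb hab hAeq
    have hdown := fun τ => isTriple_iff (τ := τ) (A := A) (d := .down) hS
      (h𝒜.inv.localIso.mul hS₁.inv) (by norm_num) ha hb hab hAinv
    refine ⟨hasSingularity_of_eq (hS₁.mul h𝒜.localIso) hS.inv one_ne_zero ha hb hab hAeq,
      ?_, fun τ hτ => ?_, fun τ hτ => (hdown τ).1 hτ⟩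
    · rintro (_ | _)
      · obtain ⟨τ, hτ⟩ := exists_isModTriple (a := E.upperVec u) (hS₁.mul h𝒜.localIso) hb 1
        exact ⟨τ, (hup τ).2 ⟨1, 1, hτ⟩⟩
      · obtain ⟨τ, hτ⟩ := exists_isModTriple (a := E.upperVec u) hS hb (-1)
        exact ⟨τ, (hdown τ).2 ⟨1, 1, hτ⟩⟩
    · obtain ⟨r, s, H⟩ := (hup τ).1 hτ
      exact ⟨r, s, (H.of_mul hS₁.1 h𝒜.localIso h𝒜.lower h𝒜.upper
        h𝒜.upper_matDeriv_lower).shift hS'.1⟩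
  · have hmem' : u + 1 ∈ Y := hY.2 hmem
    rw [toggleSign_of_mem hmem', toggleSign_of_notMem hmem]
    rw [indicator_of_mem hmem', indicator_of_notMem hmem, elemMod_zero, one_mul, mul_assoc] at hAeq
    have hAinv : A⁻¹ = S * 𝒜⁻¹ * elemMod u 1 (E.lowerVec (u + 1)) (E.upperVec (u + 1)) * S₁⁻¹ := by
      rw [hAeq, Matrix.mul_inv_rev, Matrix.mul_inv_rev, Matrix.mul_inv_rev,
        nonsing_inv_nonsing_inv _ hS.isUnit_det, elemMod_inv u _ hab', neg_neg, ← mul_assoc]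
    have hup := fun τ => isTriple_iff (τ := τ) (A := A) (d := .up) hS₁
      (h𝒜.localIso.mul hS.inv) (by norm_num) ha' hb' hab' hAeq
    have hdown := fun τ => isTriple_iff (τ := τ) (A := A) (d := .down) (hS.mul h𝒜.inv.localIso)
      hS₁.inv (one_mul 1) ha' hb' hab' hAinv
    refine ⟨hasSingularity_of_eq hS₁ (h𝒜.localIso.mul hS.inv) (by norm_num) ha' hb' hab' hAeq,
      ?_, fun τ hτ => ?_, fun τ hτ => ?_⟩
    · rintro (_ | _)
      · obtain ⟨τ, hτ⟩ := exists_isModTriple (a := E.upperVec (u + 1)) hS₁ hb' (-1)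
        exact ⟨τ, (hup τ).2 ⟨1, 1, hτ⟩⟩
      · obtain ⟨τ, hτ⟩ := exists_isModTriple (a := E.upperVec (u + 1))
          (hS.mul h𝒜.inv.localIso) hb' 1
        exact ⟨τ, (hdown τ).2 ⟨1, 1, hτ⟩⟩
    · obtain ⟨r, s, H⟩ := (hup τ).1 hτ
      exact ⟨r, s, H.shift hS'.1⟩
    · obtain ⟨r, s, H⟩ := (hdown τ).1 hτ
      exact ⟨r, s, H.of_mul hS.1 h𝒜.inv.localIso h𝒜.inv.lower h𝒜.inv.upper
        h𝒜.inv.upper_matDeriv_lower⟩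

/-! ### Transport of triples between two trivialized bundles -/

variable {Y' : Finset ℂ} {T' : Matrix (Fin p ⊕ Fin q) (Fin p ⊕ Fin q) (RatFunc ℂ)} {x ε r s : ℂ}
  {τ : Triple (Fin p ⊕ Fin q)}

/-- Transport along the gauge matrix, at a point where the two bundles coincide. -/
theorem IsTrivialization.transport (hT : E.IsTrivialization Y T) (hT' : E.IsTrivialization Y' T')
    (hx : x ∈ Y ↔ x ∈ Y')
    (H : IsModTriple (T * E.frame Y x) x (E.lowerVec x) (E.upperVec x) ε r s τ) :
    IsModTriple (T' * E.frame Y' x) x (E.lowerVec x) (E.upperVec x) ε r s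
      (τ.transport (T' * T⁻¹) x) := by
  have hS := hT.localIso x
  have hS' := hT'.localIso x
  have h1 : T' * T⁻¹ = (T' * E.frame Y' x) * (T * E.frame Y x)⁻¹ := by
    rw [inv_eq_frame_mul (E := E) Y x T, frame_congr hx, mul_assoc]
  have h2 := H.transport hS.1 (h1 ▸ hS'.mul hS.inv)
  rwa [h1, mul_assoc, nonsing_inv_mul _ hS.isUnit_det, mul_one, ← h1] at h2

/-- Transport along `T'(z + h) V(z) T(z)⁻¹`, where `V` is the d-connection or its inverse: it
carries the modifications at `x` to those at `x + h`. -/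
theorem IsTrivialization.transport_shift {h : ℂ}
    {V : Matrix (Fin p ⊕ Fin q) (Fin p ⊕ Fin q) (RatFunc ℂ)} (hT : E.IsTrivialization Y T)
    (hT' : E.IsTrivialization Y' T') (hx : x ∈ Y ↔ x + h ∈ Y') (hV : Carries E V x x (x + h))
    (H : IsModTriple (T * E.frame Y x) x (E.lowerVec x) (E.upperVec x) ε r s τ) :
    IsModTriple (T' * E.frame Y' (x + h)) (x + h) (E.lowerVec (x + h)) (E.upperVec (x + h)) ε r s
      (τ.transport (T'.map (shift h) * V * T⁻¹) x) := by
  have hS := hT.localIso x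
  have hS' := hT'.localIso (x + h)
  have hS₁ := hS'.shift
  set S := T * E.frame Y x with hSdef
  set S₁ := (T' * E.frame Y' (x + h)).map (shift h)
  have hind : indicator Y' (x + h) = indicator Y x := by simp only [indicator, hx]
  obtain ⟨hW, hWl, hWu, hWd⟩ := hV.conj (indicator Y x) rfl
  set W := elemMod x (-indicator Y x) (E.lowerVec (x + h)) (E.upperVec (x + h)) * V *
    elemMod x (indicator Y x) (E.lowerVec x) (E.upperVec x) with hWdef
  have hG : T'.map (shift h) * V * T⁻¹ = S₁ * W * S⁻¹ := by
    rw [map_shift_eq (E := E) Y' x h T', hind, inv_eq_frame_mul (E := E) Y x T, hWdef]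
    simp only [mul_assoc]
    rfl
  rw [hG]
  have h2 := H.transport hS.1 ((hS₁.mul hW).mul hS.inv)
  rw [mul_assoc, nonsing_inv_mul _ hS.isUnit_det, mul_one] at h2
  exact (h2.of_mul hS₁.1 hW hWl hWu hWd).shift hS'.1

theorem transportMatrix_self_up (hT : IsUnit T.det) (hA : A = connectionMatrix 𝒜 T) {n : ℕ}
    (e : Endpoint n) :
    transportMatrix A (T' * T⁻¹) e e .up = T'.map (shift 1) * 𝒜 * T⁻¹ := by
  have h1 : T⁻¹.map (shift 1) * T.map (shift 1) = 1 := by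
    rw [← Matrix.map_mul, nonsing_inv_mul _ hT, Matrix.map_one _ (map_zero _) (map_one _)]
  rw [transportMatrix, if_pos rfl, hA, connectionMatrix]
  rw [Matrix.map_mul, mul_assoc, mul_assoc (T.map _), ← mul_assoc (T⁻¹.map _), h1, one_mul,
    ← mul_assoc]

theorem transportMatrix_self_down (hT : IsUnit T.det) (hA : A = connectionMatrix 𝒜 T) {n : ℕ}
    (e : Endpoint n) : transportMatrix A (T' * T⁻¹) e e .down =
      T'.map (shift (-1)) * 𝒜⁻¹.map (shift (-1)) * T⁻¹ := by
  have h1 : (T' * T⁻¹) * A⁻¹ = T' * 𝒜⁻¹ * T⁻¹.map (shift 1) := by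
    rw [hA, connectionMatrix, Matrix.mul_inv_rev, Matrix.mul_inv_rev,
      nonsing_inv_nonsing_inv _ hT, map_shift_inv 1 hT, mul_assoc, ← mul_assoc T⁻¹,
      nonsing_inv_mul _ hT, one_mul, mul_assoc]
  have h2 : (T⁻¹.map (shift 1)).map (shift (-1)) = T⁻¹ := by
    ext i j
    exact shift_shift_of_add_eq_zero (by norm_num) _
  rw [transportMatrix, if_pos rfl]
  rw [h1, Matrix.map_mul, Matrix.map_mul, h2]

end Ensemble

end

theorem mainTheorem6 {p q N r : ℕ} (hp : 0 < p) (hq : 0 < q)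
    (E : Ensemble p q N) (hZ : E.Z ≠ 0)
    (ϖ₁ : Fin p → RatFunc ℂ) (ϖ₂ : Fin q → RatFunc ℂ)
    (hϖ₁ : ∀ i, ∀ x ∈ E.X, x + 1 ∈ E.X → E.ω₁ i (x + 1) / E.ω₁ i x = ratVal x (ϖ₁ i))
    (hϖ₂ : ∀ i, ∀ x ∈ E.X, x + 1 ∈ E.X → E.ω₂ i (x + 1) / E.ω₂ i x = ratVal x (ϖ₂ i))
    (c : Endpoint r → ℂ) (hc : E.Admissible c)
    (T : Matrix (Fin p ⊕ Fin q) (Fin p ⊕ Fin q) (RatFunc ℂ))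
    (hT : E.IsTrivialization (E.complement c) T)
    (A : Matrix (Fin p ⊕ Fin q) (Fin p ⊕ Fin q) (RatFunc ℂ))
    (hA : A = connectionMatrix (diagConnection ϖ₁ ϖ₂) T) :
    -- the singularities of `A`, the triples, and the elementary moves
    (∀ e, outerNeighbour c e ∈ E.complement c →
      HasSingularity A (singularPoint c e) ∧
      ∀ d, (∃ τ, IsTriple A (singularPoint c e) d τ) ∧
        ∀ τ, IsTriple A (singularPoint c e) d τ → E.Admissible (move c e d) →
          (τ.pairing ≠ 0 ↔ E.D (move c e d) ≠ 0) ∧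
          (τ.pairing ≠ 0 → E.IsTrivialization (E.complement (move c e d))
            (τ.gauge (modifiedPoint c e d) * T))) ∧
    -- the second difference logarithmic derivatives
    (∀ e d f d', outerNeighbour c e ∈ E.complement c →
      E.Admissible (move c e d) → E.Admissible (move c f d') →
      E.Admissible (move (move c e d) f d') →
      E.D (move c e d) ≠ 0 → E.D (move c f d') ≠ 0 →
      (∃ T', E.IsTrivialization (E.complement (move c f d')) T') ∧
      ∀ T', E.IsTrivialization (E.complement (move c f d')) T' →
        ∀ τ, IsTriple A (singularPoint c e) d τ →
          τ.pairing ≠ 0 ∧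
          E.D (move (move c e d) f d') * E.D c / (E.D (move c e d) * E.D (move c f d')) =
            (τ.transport (transportMatrix A (T' * T⁻¹) e f d') (modifiedPoint c e d)).pairing /
              τ.pairing) := by
  have hD : ∀ c' : Endpoint r → ℂ, E.D c' ≠ 0 ↔ E.partialSum (E.complement c') ≠ 0 := fun c' => by
    rw [Ensemble.D, ne_eq, div_eq_zero_iff, or_iff_left hZ]
  have htoggle : ∀ {c' : Endpoint r → ℂ} {e d}, E.Admissible c' → E.Admissible (move c' e d) →
      Ensemble.IsToggle E (E.complement c') (E.complement (move c' e d)) (modifiedPoint c' e d) :=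
    fun hc' hm => by
      obtain ⟨h1, h2, h3, h4⟩ := Ensemble.complement_move hc' hm
      exact ⟨h1, by rw [h2, h3, not_not], h4⟩
  have hcarry : ∀ {u}, u ∈ E.X → u + 1 ∈ E.X →
      Ensemble.Carries E (diagConnection ϖ₁ ϖ₂) u u (u + 1) :=
    fun hu hu' => Ensemble.carries_diagConnection hϖ₁ hϖ₂ hu hu'
  have hsing := fun e (he : outerNeighbour c e ∈ E.complement c) =>
    have h := Ensemble.singularPoint_mem hc he
    hT.singularity hp hq hA (hcarry h.1 h.2.1) h.1 h.2.1 h.2.2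
  -- a triple of `A` is a triple of the modification of the bundle at the modified point
  have hmod : ∀ e, outerNeighbour c e ∈ E.complement c → ∀ d τ,
      IsTriple A (singularPoint c e) d τ → ∃ r s,
        IsModTriple (T * E.frame (E.complement c) (modifiedPoint c e d)) (modifiedPoint c e d)
          (E.lowerVec (modifiedPoint c e d)) (E.upperVec (modifiedPoint c e d))
          (Ensemble.toggleSign (E.complement c) (modifiedPoint c e d)) r s τ := by
    rintro e he (_ | _) τ hτ
    · exact (hsing e he).2.2.1 τ hτ
    · exact (hsing e he).2.2.2 τ hτ
  refine ⟨fun e he => ⟨(hsing e he).1, fun d => ⟨(hsing e he).2.1 d, fun τ hτ hm => ?_⟩⟩,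
    fun e d f d' he hce hcf hcef hDe hDf =>
      ⟨hT.exists_of_toggle hq (htoggle hc hcf) ((hD _).1 hDf), fun T' hT' τ hτ => ?_⟩⟩
  · obtain ⟨a, b, H⟩ := hmod e he d τ hτ
    rw [hD]
    exact ⟨hT.pairing_ne_zero_iff (htoggle hc hm) H, hT.gauge_mul (htoggle hc hm) H⟩
  obtain ⟨a, b, H⟩ := hmod e he d τ hτ
  have hP : τ.pairing ≠ 0 :=
    (hT.pairing_ne_zero_iff (htoggle hc hce) H).2 ((hD _).1 hDe)
  refine ⟨hP, ?_⟩
  have hcfe : E.Admissible (move (move c f d') e d) := by rwa [move_move_comm]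
  have hme := Ensemble.complement_move hc hce
  have hmf := Ensemble.complement_move hc hcf
  have hmfe := Ensemble.complement_move hcf hcfe
  set x := modifiedPoint c e d with hx
  set y := modifiedPoint (move c f d') e d with hy
  have hmem : x ∈ E.complement c ↔ y ∈ E.complement (move c f d') := hme.2.1.trans hmfe.2.1.symm
  have hsign : Ensemble.toggleSign (E.complement (move c f d')) y =
      Ensemble.toggleSign (E.complement c) x := by
    simp only [Ensemble.toggleSign, Ensemble.indicator, hmem]
  -- the transported triple belongs to the same move, made after the move of `f`
  have H' : IsModTriple (T' * E.frame (E.complement (move c f d')) y) y (E.lowerVec y)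
      (E.upperVec y) (Ensemble.toggleSign (E.complement (move c f d')) y) a b
      (τ.transport (transportMatrix A (T' * T⁻¹) e f d') x) := by
    rw [hsign]
    by_cases hef : e = f
    · subst hef
      have hxy : y = x + d'.val := modifiedPoint_move_self c e d d'
      rw [hxy] at hmem hmfe ⊢
      cases d'
      · rw [Ensemble.transportMatrix_self_up hT.1 hA]
        exact hT.transport_shift hT' hmem (hcarry hme.1 hmfe.1) H
      · rw [Ensemble.transportMatrix_self_down hT.1 hA]
        have hx1 : x + Dir.down.val + 1 = x := by simp [Dir.val]
        have h1 := hcarry hmfe.1 (by rw [hx1]; exact hme.1)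
        rw [hx1] at h1
        exact hT.transport_shift hT' hmem h1.inv.shift H
    · have hxy : y = x := modifiedPoint_move_of_ne c hef d d'
      rw [hxy] at hmem ⊢
      rw [show transportMatrix A (T' * T⁻¹) e f d' = T' * T⁻¹ by simp [transportMatrix, hef]]
      exact hT.transport hT' hmem H
  have h1 := hT.partialSum_toggle (Ensemble.toggleSign_mul_self _ _) (htoggle hc hce).gram_eq H
  have h2 := hT'.partialSum_toggle (Ensemble.toggleSign_mul_self _ _)
    (htoggle hcf hcfe).gram_eq H'
  rw [hsign, move_move_comm c f e] at h2
  have hab : a * b ≠ 0 := mul_ne_zero H.r_ne H.s_ne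
  have hε := Ensemble.toggleSign_ne_zero (E.complement c) x
  have he0 := (hD _).1 hDe
  have hf0 := (hD _).1 hDf
  simp only [Ensemble.D]
  rw [div_mul_div_comm, div_mul_div_comm, div_div_div_cancel_right₀ (mul_ne_zero hZ hZ),
    div_eq_div_iff (mul_ne_zero he0 hf0) hP]
  refine mul_left_cancel₀ (mul_ne_zero hab (neg_ne_zero.2 hε)) ?_
  set ε := Ensemble.toggleSign (E.complement c) x
  linear_combination (-ε * τ.pairing * E.partialSum (E.complement c)) * h2 + (ε *
    (τ.transport (transportMatrix A (T' * T⁻¹) e f d') x).pairing *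
      E.partialSum (E.complement (move c f d'))) * h1
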